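/- Notation. A frieze is an array of shifted rows: a row of zeros, then a row of ones, then rows of positive integers, such that every diamond of entries $b$ (top), $a$ (left), $d$ (right), $c$ (bottom) satisfies $ad-bc=1$. Either the rows of positive integers go on for ever (an infinite frieze), or after finitely many of them (possibly none) a second row of ones and a second row of zeros follow and the array stops (a finite frieze). The row directly below the first row of ones is the quiddity row $(a_i)_{i\in\mathbb Z}$. If it has period $n\ge 1$ (not necessarily the shortest period), the frieze is called periodic with quiddity sequence $(a_1,\dots,a_n)$. For $n\ge1$, $m\ge 0$ let $A_{n,m}$ be an annulus with $n$ marked points $1,\dots,n$ in this order on the outer boundary circle and $m$ marked points on the inner one; fix a meridian, i.e. a non-contractible simple closed curve in the interior. A finite arc is a curve joining marked points that has no self-intersections (its endpoints may coincide), runs in the interior of the annulus apart from its endpoints, and is neither contractible nor homotopic to a boundary segment, taken up to orientation and up to homotopy (equivalently, isotopy) fixing the endpoints. An asymptotic arc is a curve without self-intersections that starts at a marked point and spirals infinitely often, in one of the two directions, towards the meridian from its side of it, taken up to deformation fixing its starting point. Two arcs are compatible if they have representatives that do not intersect except possibly in endpoints. A triangulation of $A_{n,m}$ is a maximal collection of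 pairwise compatible (finite or asymptotic) arcs. Its outer quiddity sequence is $(a_1,\dots,a_n)$, where $a_i$ is the number of triangles incident with a lift of the outer marked point $i$ in the induced triangulation of the universal cover (an infinite strip; lifts of asymptotic arcs are considered to end in limit points at the two ends of the strip). **Theorem.** Let $\mathcal F$ be a periodic frieze with quiddity sequence $(a_1,\dots,a_n)$, $n\ge 1$. Then $\mathcal F$ is finite, or there are an integer $m\ge 0$ and a triangulation of $A_{n,m}$ whose outer quiddity sequence is $(a_1,\dots,a_n)$. -/

import Mathlib

/-! ### Friezes -/

/-- A frieze of positive integers, finite or infinite.  Below the row of zeros (entries `(i, i-2)`)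
and the row of ones (entries `(i, i-1)`) there are `width` rows of positive integers, the
`k`-th of which (counted from `0`) consists of the entries `(i, i+k)`.  If `width = ⊤` the frieze is
infinite; if `width` is a natural number `w`, these rows are followed by a second row of ones
and a second row of zeros, and the array stops there (values of `entry` at positions outside the
array carry no meaning).  Every diamond contained in the array satisfies the unimodular rule. -/
structure Frieze where
  width : ℕ∞
  entry : ℤ → ℤ → ℤ
  top_zero : ∀ i : ℤ, entry i (i - 2) = 0
  top_one : ∀ i : ℤ, entry i (i - 1) = 1
  pos : ∀ (i : ℤ) (k : ℕ), (k : ℕ∞) < width → 0 < entry i (i + k)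
  bottom_one : ∀ (i : ℤ) (w : ℕ), width = (w : ℕ∞) → entry i (i + w) = 1
  bottom_zero : ∀ (i : ℤ) (w : ℕ), width = (w : ℕ∞) → entry i (i + w + 1) = 0
  /-- The diamond with corners `(i,j)`, `(i+1,j)`, `(i,j+1)`, `(i+1,j+1)`, where `j = i - 1 + k`. -/
  unimodular : ∀ (i : ℤ) (k : ℕ), (k : ℕ∞) ≤ width + 1 →
    entry i (i - 1 + k) * entry (i + 1) (i - 1 + k + 1)
      - entry (i + 1) (i - 1 + k) * entry i (i - 1 + k + 1) = 1

namespace Frieze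

/-- The frieze has finitely many rows. -/
def IsFinite (F : Frieze) : Prop := F.width ≠ ⊤

/-- `F` is `n`-periodic with quiddity sequence `(a_1, …, a_n)`: its quiddity row (the row right below
the first row of ones) is the `n`-periodic repetition of this tuple.  The tuple is indexed by
`Fin n`, so that `a i` is the member `a_{i+1}`. -/
def HasQuidditySequence (F : Frieze) {n : ℕ} (a : Fin n → ℕ) : Prop :=
  ∀ (i : Fin n) (k : ℤ),
    F.entry ((i : ℤ) + 1 + k * n) ((i : ℤ) + 1 + k * n) = (a i : ℤ)

end Frieze

namespace AnnulusTriangulation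

/-! ### The annulus, its universal cover and its marked points -/

/-- The annulus, as a cylinder of height `1`; height `0` is the outer boundary circle, height `1`
the inner one. -/
abbrev Annulus : Type := UnitAddCircle × unitInterval

/-- The universal cover of the annulus: an infinite strip of height `1`. -/
abbrev Strip : Type := ℝ × unitInterval

/-- The covering map, wrapping the strip around the cylinder. -/
def cover : C(Strip, Annulus) where
  toFun p := ((p.1 : UnitAddCircle), p.2)
  continuous_toFun :=
    ((AddCircle.continuous_mk' (1 : ℝ)).comp continuous_fst).prodMk continuous_snd

/-- The marked points of the strip on the lower boundary (for `n` marked points on the outer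
boundary circle). -/
noncomputable def outerPoint (n : ℕ) (k : ℤ) : Strip := ((k : ℝ) / n, 0)

/-- The marked points of the strip on the upper boundary (for `m > 0` marked points on the inner
boundary circle). -/
noncomputable def innerPoint (m : ℕ) (k : ℤ) : Strip := ((k : ℝ) / m, 1)

/-- The `n` marked points on the outer and `m` marked points on the inner boundary of `A_{n,m}`. -/
def IsMarked (n m : ℕ) (p : Annulus) : Prop :=
  (0 < n ∧ ∃ k : ℤ, p = cover (outerPoint n k)) ∨ (0 < m ∧ ∃ k : ℤ, p = cover (innerPoint m k))

/-- The boundary segment of the outer boundary from the `k`-th marked point to the next one. -/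
noncomputable def outerSegment (n : ℕ) (k : ℤ) : C(unitInterval, Annulus) where
  toFun t := cover (((k : ℝ) + (t : ℝ)) / n, 0)
  continuous_toFun := by fun_prop

/-- The boundary segment of the inner boundary from the `k`-th marked point to the next one. -/
noncomputable def innerSegment (m : ℕ) (k : ℤ) : C(unitInterval, Annulus) where
  toFun t := cover (((k : ℝ) + (t : ℝ)) / m, 1)
  continuous_toFun := by fun_prop

/-! ### Finite arcs -/

/-- The same curve, run through backwards. -/
def reverse (γ : C(unitInterval, Annulus)) : C(unitInterval, Annulus) where
  toFun t := γ (unitInterval.symm t)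
  continuous_toFun := by fun_prop

/-- Two curves agree up to homotopy fixing the endpoints and up to orientation.  (For the simple
curves used below, homotopy and isotopy fixing the endpoints are the same relation.) -/
def SameClass (γ δ : C(unitInterval, Annulus)) : Prop :=
  γ.HomotopicRel δ {0, 1} ∨ (reverse γ).HomotopicRel δ {0, 1}

theorem reverse_reverse (γ : C(unitInterval, Annulus)) : reverse (reverse γ) = γ := by
  ext t <;> simp [reverse]

theorem reverse_homotopicRel {γ δ : C(unitInterval, Annulus)} (h : γ.HomotopicRel δ {0, 1}) :
    (reverse γ).HomotopicRel (reverse δ) {0, 1} := by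
  obtain ⟨H⟩ := h
  refine ⟨⟨⟨⟨fun p => H (p.1, unitInterval.symm p.2), by fun_prop⟩, fun x => ?_, fun x => ?_⟩,
    fun t x hx => ?_⟩⟩
  · simp [reverse]
  · simp [reverse]
  · have hs : unitInterval.symm x ∈ ({0, 1} : Set unitInterval) := by
      rcases hx with rfl | rfl <;> simp
    simpa [reverse] using H.eq_fst t hs

theorem sameClass_equivalence : Equivalence SameClass where
  refl γ := Or.inl (.refl γ)
  symm := by
    rintro γ δ (h | h)
    · exact Or.inl h.symm
    · right
      have := reverse_homotopicRel h.symm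
      rwa [reverse_reverse] at this
  trans := by
    rintro γ δ ε (h | h) (k | k)
    · exact Or.inl (h.trans k)
    · exact Or.inr ((reverse_homotopicRel h).trans k)
    · exact Or.inr (h.trans k)
    · left
      have := reverse_homotopicRel h
      rw [reverse_reverse] at this
      exact this.trans k

/-- A curve in `A_{n,m}` that represents a finite arc: its endpoints are marked points, it runs in
the interior of the annulus otherwise, it has no self-intersections (but the endpoints
may coincide), it is not contractible, and it is not a boundary segment up to homotopy. -/
structure IsArcCurve (n m : ℕ) (γ : C(unitInterval, Annulus)) : Prop where
  marked_zero : IsMarked n m (γ 0)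
  marked_one : IsMarked n m (γ 1)
  interior : ∀ t ∈ Set.Ioo (0 : unitInterval) 1, (γ t).2 ∈ Set.Ioo (0 : unitInterval) 1
  simple : Set.InjOn γ (Set.Ioo 0 1)
  not_contractible : ¬ γ.HomotopicRel (ContinuousMap.const unitInterval (γ 0)) {0, 1}
  not_outerSegment : ∀ k : ℤ, 0 < n → ¬ SameClass γ (outerSegment n k)
  not_innerSegment : ∀ k : ℤ, 0 < m → ¬ SameClass γ (innerSegment m k)

/-- The curves representing finite arcs, considered up to homotopy and orientation. -/
def finiteArcSetoid (n m : ℕ) : Setoid {γ : C(unitInterval, Annulus) // IsArcCurve n m γ} where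
  r γ δ := SameClass γ.1 δ.1
  iseqv := ⟨fun γ => sameClass_equivalence.refl γ.1, fun h => sameClass_equivalence.symm h,
    fun h k => sameClass_equivalence.trans h k⟩

/-- The finite arcs of `A_{n,m}`. -/
abbrev FiniteArc (n m : ℕ) : Type := Quotient (finiteArcSetoid n m)

/-! ### Asymptotic arcs -/

/-- The two directions in which a curve can wind around the meridian. -/
inductive Direction
  | right
  | left

/-- The end of the real line in the given direction. -/
def Direction.toFilter : Direction → Filter ℝ
  | .right => Filter.atTop
  | .left => Filter.atBot

/-- The height of the meridian `z`, the closed curve in the middle of the annulus. -/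
noncomputable def meridian : unitInterval := ⟨1 / 2, by norm_num, by norm_num⟩

/-- A curve `ρ` in the strip which, in the annulus, approaches the meridian while winding around it
infinitely often in direction `d`. -/
def StripSpirals (d : Direction) (ρ : C(NNReal, Strip)) : Prop :=
  Filter.Tendsto (fun t => (ρ t).1) Filter.atTop d.toFilter ∧
    Filter.Tendsto (fun t => (ρ t).2) Filter.atTop (nhds meridian)

/-- A curve in the annulus which approaches the meridian while winding around it infinitely often in
direction `d`. -/
def Spirals (d : Direction) (γ : C(NNReal, Annulus)) : Prop :=
  ∃ ρ : C(NNReal, Strip), cover.comp ρ = γ ∧ StripSpirals d ρ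

/-- A curve in `A_{n,m}` that represents an asymptotic arc with direction `d`: it starts at a marked
point, then stays strictly between that boundary circle and the meridian, has no
self-intersections, and spirals towards the meridian. -/
structure IsAsymptoticCurve (n m : ℕ) (d : Direction) (γ : C(NNReal, Annulus)) : Prop where
  marked_zero : IsMarked n m (γ 0)
  interior : ∀ t : NNReal, 0 < t →
    ((γ 0).2 = 0 ∧ (γ t).2 ∈ Set.Ioo 0 meridian) ∨ ((γ 0).2 = 1 ∧ (γ t).2 ∈ Set.Ioo meridian 1)
  simple : Function.Injective γ
  spirals : Spirals d γ

/-- The curves representing asymptotic arcs with direction `d`, considered up to deformation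
through curves that start at the same point and spiral in direction `d` towards the meridian. -/
def asymptoticArcSetoid (n m : ℕ) (d : Direction) :
    Setoid {γ : C(NNReal, Annulus) // IsAsymptoticCurve n m d γ} where
  r γ δ := γ.1.HomotopicWith δ.1 (fun h => h 0 = γ.1 0 ∧ Spirals d h)
  iseqv := by
    have start : ∀ γ δ : {γ : C(NNReal, Annulus) // IsAsymptoticCurve n m d γ},
        γ.1.HomotopicWith δ.1 (fun h => h 0 = γ.1 0 ∧ Spirals d h) → δ.1 0 = γ.1 0 := by
      rintro γ δ ⟨H⟩
      have := (H.prop 1).1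
      rwa [ContinuousMap.Homotopy.curry_one] at this
    refine ⟨fun γ => .refl _ ⟨rfl, γ.2.spirals⟩, fun {γ δ} h => ?_, fun {γ δ ε} h k => ?_⟩
    · have e := start γ δ h
      rw [← e] at h
      exact h.symm
    · have e := start γ δ h
      rw [e] at k
      exact h.trans k

/-- The asymptotic arcs of `A_{n,m}` with direction `d`; on each of the two boundaries, one of the
directions gives the Prüfer arcs and the other one gives the adic arcs. -/
abbrev AsymptoticArc (n m : ℕ) (d : Direction) : Type := Quotient (asymptoticArcSetoid n m d)

/-! ### Arcs, compatibility and triangulations -/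

/-- The arcs of `A_{n,m}`: the finite arcs together with the asymptotic arcs. -/
inductive Arc (n m : ℕ)
  | finite (α : FiniteArc n m)
  | asymptotic (d : Direction) (α : AsymptoticArc n m d)

/-- `IsTrace α S` says that some curve representing the arc `α` traces out the set `S`, apart from its
endpoints. -/
def IsTrace {n m : ℕ} : Arc n m → Set Annulus → Prop
  | .finite α, S => ∃ γ : {γ : C(unitInterval, Annulus) // IsArcCurve n m γ},
      Quotient.mk (finiteArcSetoid n m) γ = α ∧ S = γ.1 '' Set.Ioo 0 1
  | .asymptotic d α, S => ∃ γ : {γ : C(NNReal, Annulus) // IsAsymptoticCurve n m d γ},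
      Quotient.mk (asymptoticArcSetoid n m d) γ = α ∧ S = γ.1 '' Set.Ioi 0

/-- Two arcs are compatible if they have representatives that do not intersect (common endpoints
are allowed). -/
def Compatible {n m : ℕ} (α β : Arc n m) : Prop :=
  ∃ S S' : Set Annulus, IsTrace α S ∧ IsTrace β S' ∧ Disjoint S S'

/-- A triangulation of `A_{n,m}` is a maximal collection of pairwise compatible arcs. -/
def IsTriangulation {n m : ℕ} (T : Set (Arc n m)) : Prop :=
  Maximal (fun S : Set (Arc n m) => S.Pairwise Compatible) T

/-! ### The induced triangulation of the universal cover -/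

/-- The vertices of triangles in the universal cover: the marked points of the lower and the upper
boundary, and the limit points at the two ends of the strip, towards which lifts of
asymptotic arcs run. -/
inductive Vertex
  | outer (k : ℤ)
  | inner (k : ℤ)
  | limit (d : Direction)

/-- `p` and `q` are the endpoints of a lift of a finite arc of `T`. -/
def LiftJoins {n m : ℕ} (T : Set (Arc n m)) (p q : Strip) : Prop :=
  ∃ (c : C(unitInterval, Strip)) (h : IsArcCurve n m (cover.comp c)),
    c 0 = p ∧ c 1 = q ∧ Arc.finite (Quotient.mk (finiteArcSetoid n m) ⟨cover.comp c, h⟩) ∈ T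

/-- Some lift of an asymptotic arc of `T` starts at `p` and runs off in direction `d`. -/
def LiftEscapes {n m : ℕ} (T : Set (Arc n m)) (p : Strip) (d : Direction) : Prop :=
  ∃ (ρ : C(NNReal, Strip)) (h : IsAsymptoticCurve n m d (cover.comp ρ)),
    ρ 0 = p ∧
      Arc.asymptotic d (Quotient.mk (asymptoticArcSetoid n m d) ⟨cover.comp ρ, h⟩) ∈ T

/-- There is an edge between two vertices: a lift of an arc of `T` or a boundary segment. -/
inductive Edge {n m : ℕ} (T : Set (Arc n m)) : Vertex → Vertex → Prop
  | outer_outer (k l : ℤ) : LiftJoins T (outerPoint n k) (outerPoint n l) →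
      Edge T (.outer k) (.outer l)
  | inner_inner (k l : ℤ) : 0 < m → LiftJoins T (innerPoint m k) (innerPoint m l) →
      Edge T (.inner k) (.inner l)
  | outer_inner (k l : ℤ) : 0 < m → LiftJoins T (outerPoint n k) (innerPoint m l) →
      Edge T (.outer k) (.inner l)
  | outer_limit (k : ℤ) (d : Direction) : LiftEscapes T (outerPoint n k) d →
      Edge T (.outer k) (.limit d)
  | inner_limit (k : ℤ) (d : Direction) : 0 < m → LiftEscapes T (innerPoint m k) d →
      Edge T (.inner k) (.limit d)
  | outer_segment (k : ℤ) : Edge T (.outer k) (.outer (k + 1))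
  | inner_segment (k : ℤ) : 0 < m → Edge T (.inner k) (.inner (k + 1))

/-- The triangles of the induced triangulation of the universal cover, given by their vertices: three
distinct vertices, any two of which are joined by an edge.  (All vertices lie on the
boundary of the strip and the edges do not cross, so three such edges bound a region of
the triangulation, and every region arises in this way.) -/
def IsTriangle {n m : ℕ} (T : Set (Arc n m)) (Δ : Finset Vertex) : Prop :=
  Δ.card = 3 ∧ ∀ u ∈ Δ, ∀ v ∈ Δ, u ≠ v → Edge T u v ∨ Edge T v u

/-- `(a_1, …, a_n)` is the outer quiddity sequence of `T`: in the universal cover, exactly `a_i`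
triangles are incident with the `i`-th vertex of the lower boundary. -/
def IsQuiddityOf {n m : ℕ} (a : Fin n → ℕ) (T : Set (Arc n m)) : Prop :=
  ∀ i : Fin n,
    Set.encard {Δ : Finset Vertex | IsTriangle T Δ ∧ Vertex.outer (i : ℕ) ∈ Δ} = (a i : ℕ∞)

/-- `(a_1, …, a_n)` can be realized in the annulus `A_{n,m}`. -/
def RealizableIn {n : ℕ} (a : Fin n → ℕ) (m : ℕ) : Prop :=
  ∃ T : Set (Arc n m), IsTriangulation T ∧ IsQuiddityOf a T

end AnnulusTriangulation

/-!
An infinite frieze with quiddity row `a` labels all chords of a polygon with vertex set `ℤ`: if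
the vectors `v k` are the fundamental solution of `v (k + 1) = a k • v k - v (k - 1)`, the label
of the chord from `i` to `j` is `det (v i, v j)`, and the Plücker relation makes these labels
satisfy Ptolemy's relation. Two chords with label `1` do not cross, as the Ptolemy relation would
write `1` as a sum of two positive integers. The chords with label `1` triangulate everything they
cut off; periodicity leaves vertices over which none of them passes. At such a vertex `k` the
number of triangles present falls short of `a k = det (v (k - 1), v (k + 1))` by some `g ≥ 2`.
Joining `k` to `g - 1` consecutive marked points on the inner boundary, the first of which is the
last one joined to the preceding such vertex, supplies exactly `g` triangles. If `g = 2` for all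
these vertices, there is no need for inner marked points and arcs spiralling in one and the same
direction do the job.

Whether lifts of arcs cross depends only on their endpoints: the strip is the Klein disc without
two boundary points, paths in a disc with linked endpoints meet, and geodesics with unlinked
endpoints do not. So the arcs of the annulus can be drawn as geodesics, and a curve that is
compatible with all of them has to have the endpoints of one of them.
-/

section Evolution

variable {α : Type*} (e : ℤ → Equiv.Perm α) (a : α)

/-- The two-sided orbit `k ↦ x k` of the non-autonomous recursion `x (k + 1) = e k (x k)` with
`x 0 = a`. -/
def evolve (k : ℤ) : α :=
  k.inductionOn' 0 a (fun k _ => e k) fun k _ => (e (k - 1)).symm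

@[simp] theorem evolve_zero : evolve e a 0 = a := Int.inductionOn'_self

theorem evolve_add_one (k : ℤ) : evolve e a (k + 1) = e k (evolve e a k) := by
  rcases le_or_gt 0 k with hk | hk
  · exact Int.inductionOn'_add_one hk
  · have h : evolve e a (k + 1 - 1) = (e (k + 1 - 1)).symm (evolve e a (k + 1)) :=
      Int.inductionOn'_sub_one (by lia)
    rw [add_sub_cancel_right] at h
    rw [h, Equiv.apply_symm_apply]

end Evolution

/-- A frieze-like labelling of the chords of a polygon with vertex set `ℤ`: `L i j` is the label of
the chord from `i` to `j`, with a sign that records its orientation. All labels are positive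
integers, the sides have label `1`, and the Ptolemy relation holds; in view of the signs, it holds
for every quadruple of vertices. -/
structure PtolemyPattern where
  L : ℤ → ℤ → ℤ
  antisymm : ∀ i j, L j i = -L i j
  L_succ : ∀ i, L i (i + 1) = 1
  L_pos : ∀ {i j}, i < j → 0 < L i j
  ptolemy : ∀ i j k l, L i k * L j l = L i j * L k l + L i l * L j k

namespace PtolemyPattern

variable (P : PtolemyPattern) {i j k l : ℤ}

theorem L_self (i : ℤ) : P.L i i = 0 := by
  have := P.antisymm i i
  lia

theorem L_nonneg (h : i ≤ j) : 0 ≤ P.L i j := by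
  rcases eq_or_lt_of_le h with rfl | h
  · rw [P.L_self]
  · exact (P.L_pos h).le

/-- The chords with label `1`, among them the sides of the polygon. -/
def UnitChord (i j : ℤ) : Prop := i < j ∧ P.L i j = 1

theorem unitChord_succ (i : ℤ) : P.UnitChord i (i + 1) := ⟨by lia, P.L_succ i⟩

theorem unitChord_pred (i : ℤ) : P.UnitChord (i - 1) i := by
  simpa using P.unitChord_succ (i - 1)

variable {P}

theorem UnitChord.noncrossing (hik : P.UnitChord i k) (hjl : P.UnitChord j l) (hij : i < j)
    (hjk : j < k) : l ≤ k := by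
  by_contra! hkl
  have h := P.ptolemy i j k l
  rw [hik.2, hjl.2] at h
  nlinarith [mul_pos (P.L_pos hij) (P.L_pos hkl),
    mul_pos (P.L_pos (hij.trans hjl.1)) (P.L_pos hjk)]

/-- At the least `k` with `L k j ≤ L i k`, the Ptolemy relation of `i, k - 1, k, j` leaves no room
for labels other than `1`. -/
theorem UnitChord.exists_split (h : P.UnitChord i j) (hij : j ≠ i + 1) :
    ∃ k, P.UnitChord i k ∧ P.UnitChord k j := by
  obtain ⟨hlt, hL⟩ := h
  obtain ⟨k, ⟨hik, hkj, hk⟩, hmin⟩ :=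
    Int.exists_least_of_bdd (P := fun k => i < k ∧ k ≤ j ∧ P.L k j ≤ P.L i k)
      ⟨i, fun z hz => hz.1.le⟩ ⟨j, hlt, le_rfl, by rw [P.L_self, hL]; exact zero_le_one⟩
  rcases eq_or_lt_of_le (show i + 1 ≤ k from hik) with rfl | hik'
  · have hpos : 0 < P.L (i + 1) j := P.L_pos (by lia)
    rw [P.L_succ] at hk
    exact ⟨i + 1, P.unitChord_succ i, by lia, by lia⟩
  have hprev : P.L i (k - 1) < P.L (k - 1) j := by
    by_contra! hle
    have := hmin (k - 1) ⟨by lia, by lia, hle⟩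
    lia
  have hptolemy := P.ptolemy i (k - 1) k j
  rw [hL, (P.unitChord_pred k).2] at hptolemy
  have hpos := P.L_pos (show i < k - 1 by lia)
  have hik1 : P.L i k = 1 := by nlinarith [P.L_pos hik]
  rcases eq_or_lt_of_le hkj with rfl | hkj'
  · rw [P.L_self] at hptolemy
    nlinarith
  · have := P.L_pos hkj'
    exact ⟨k, ⟨hik, hik1⟩, hkj', by lia⟩

variable (P)

/-- A vertex is skeletal if no chord with label `1` passes over it. -/
def Skeletal (k : ℤ) : Prop := ∀ ⦃i j⦄, P.UnitChord i j → i < k → j ≤ k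

variable {P}

theorem UnitChord.not_skeletal (h : P.UnitChord i j) (hik : i < k) (hkj : k < j) :
    ¬ P.Skeletal k := fun hk => (hk h hik).not_gt hkj

theorem exists_unit_triangle_over (hk : ¬ P.Skeletal k) :
    ∃ i j, P.UnitChord i j ∧ P.UnitChord i k ∧ P.UnitChord k j := by
  simp only [Skeletal, not_forall, not_le] at hk
  obtain ⟨i, j, h, hik, hkj⟩ := hk
  induction hN : (j - i).toNat using Nat.strong_induction_on generalizing i j with
  | _ N ih =>
    obtain ⟨l, hil, hlj⟩ := h.exists_split (by lia)
    have := hil.1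
    have := hlj.1
    rcases lt_trichotomy l k with hlk | rfl | hkl
    · exact ih _ (by lia) l j hlj hlk hkj rfl
    · exact ⟨i, j, h, hil, hlj⟩
    · exact ih _ (by lia) i l hil hik hkl rfl

theorem unitChord_of_noncrossing (hij : i < j) (hsk : ∀ k, i < k → k < j → ¬ P.Skeletal k)
    (hright : ∀ k l, i < k → k < j → P.UnitChord k l → l ≤ j)
    (hleft : ∀ k l, i < l → l < j → P.UnitChord k l → i ≤ k) : P.UnitChord i j := by
  obtain ⟨p, ⟨hip, hpj⟩, hmax⟩ :=
    Int.exists_greatest_of_bdd (P := fun p => P.UnitChord i p ∧ p ≤ j)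
      ⟨j, fun z hz => hz.2⟩ ⟨i + 1, P.unitChord_succ i, hij⟩
  rcases eq_or_lt_of_le hpj with rfl | hpj
  · exact hip
  obtain ⟨s, t, hst, hsp, hpt⟩ := exists_unit_triangle_over (hsk p hip.1 hpj)
  have htj := hright p t hip.1 hpj hpt
  rcases eq_or_lt_of_le (hleft s p hip.1 hpj hsp) with rfl | his
  · exact absurd (hmax t ⟨hst, htj⟩) hpt.1.not_ge
  · exact absurd (hip.noncrossing hst his hsp.1) hpt.1.not_ge

variable (P)

/-- The position of a neighbour `i` of `k` in the fan of triangles at `k`, counted from `k + 1`. -/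
def label (k i : ℤ) : ℤ := P.L k i * P.L (k + 1) i

theorem label_succ (k : ℤ) : P.label k (k + 1) = 0 := by rw [label, P.L_self, mul_zero]

theorem label_pred (k : ℤ) : P.label k (k - 1) = P.L (k - 1) (k + 1) := by
  rw [label, P.antisymm (k - 1) k, P.antisymm (k - 1) (k + 1), (P.unitChord_pred k).2]
  ring

variable {P}

theorem UnitChord.label_right (h : P.UnitChord k j) : P.label k j = P.L (k + 1) j := by
  rw [label, h.2, one_mul]

theorem UnitChord.L_sq_right (h : P.UnitChord k j) : P.L k j ^ 2 = 1 := by rw [h.2, one_pow]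

theorem UnitChord.L_sq_left (h : P.UnitChord i k) : P.L k i ^ 2 = 1 := by
  rw [P.antisymm i k, h.2]
  norm_num

theorem UnitChord.label_nonneg (h : P.UnitChord k j) : 0 ≤ P.label k j := by
  rw [h.label_right]
  exact P.L_nonneg h.1

theorem label_sub_label (hi : P.L k i ^ 2 = 1) (hj : P.L k j ^ 2 = 1) :
    P.label k j - P.label k i = P.L k i * P.L k j * P.L i j := by
  have h := P.ptolemy k (k + 1) i j
  rw [P.L_succ] at h
  simp only [label]
  linear_combination P.L k i * P.L k j * h - P.L k j * P.L (k + 1) j * hi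
    + P.L k i * P.L (k + 1) i * hj

theorem eq_of_label_eq (hi : P.L k i ^ 2 = 1)
    (hj : P.L k j ^ 2 = 1) (h : P.label k i = P.label k j) : i = j := by
  have hL : P.L i j = 0 := by
    have := label_sub_label hi hj
    rw [h, sub_self, eq_comm, mul_eq_zero, mul_eq_zero] at this
    rcases this with (h0 | h0) | h0
    · simp [h0] at hi
    · simp [h0] at hj
    · exact h0
  rcases lt_trichotomy i j with hij | hij | hij
  · exact absurd hL (P.L_pos hij).ne'
  · exact hij
  · exact absurd (P.antisymm i j ▸ neg_eq_zero.2 hL) (P.L_pos hij).ne'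

theorem UnitChord.exists_label_eq_sub_one (h : P.UnitChord k j) (hj : j ≠ k + 1) :
    ∃ i, P.UnitChord k i ∧ P.label k i = P.label k j - 1 := by
  obtain ⟨i, hki, hij⟩ := h.exists_split hj
  have := label_sub_label hki.L_sq_right h.L_sq_right
  rw [hki.2, h.2, hij.2] at this
  exact ⟨i, hki, by lia⟩

theorem UnitChord.exists_label_eq_add_one (h : P.UnitChord i k) (hi : i ≠ k - 1) :
    ∃ j, P.UnitChord j k ∧ P.label k j = P.label k i + 1 := by
  obtain ⟨j, hij, hjk⟩ := h.exists_split (by lia)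
  have := label_sub_label h.L_sq_left hjk.L_sq_left
  rw [P.antisymm i k, P.antisymm j k, h.2, hjk.2, hij.2] at this
  exact ⟨j, hjk, by lia⟩

theorem UnitChord.exists_label_right (h : P.UnitChord k j) {t : ℤ} (ht : 0 ≤ t)
    (htj : t ≤ P.label k j) : ∃ i, P.UnitChord k i ∧ P.label k i = t := by
  induction t, htj using Int.leInductionDown with
  | base => exact ⟨j, h, rfl⟩
  | pred t htj ih =>
    obtain ⟨i, hki, rfl⟩ := ih (by lia)
    refine hki.exists_label_eq_sub_one ?_
    rintro rfl
    rw [P.label_succ] at ht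
    lia

theorem UnitChord.exists_label_left (h : P.UnitChord i k) {t : ℤ} (hit : P.label k i ≤ t)
    (ht : t ≤ P.L (k - 1) (k + 1)) : ∃ j, P.UnitChord j k ∧ P.label k j = t := by
  induction t, hit using Int.leInduction with
  | base => exact ⟨i, h, rfl⟩
  | succ t hit ih =>
    obtain ⟨j, hjk, rfl⟩ := ih (by lia)
    refine hjk.exists_label_eq_add_one ?_
    rintro rfl
    rw [P.label_pred] at ht
    lia

end PtolemyPattern

/-- A pattern of period `n`, such as the one of an infinite frieze with quiddity sequence
`(a_1, …, a_n)`. -/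
structure PeriodicPattern extends PtolemyPattern where
  n : ℕ
  n_pos : 0 < n
  L_add_period : ∀ i j, L (i + n) (j + n) = L i j

namespace PeriodicPattern

open PtolemyPattern

variable (P : PeriodicPattern) {i j k l : ℤ}

theorem L_shift (i j τ : ℤ) : P.L (i + τ * P.n) (j + τ * P.n) = P.L i j := by
  have h : Function.Periodic (fun τ : ℤ => P.L (i + τ * P.n) (j + τ * P.n)) 1 := fun τ => by
    simpa only [add_mul, one_mul, ← add_assoc] using P.L_add_period _ _
  simpa using h.int_mul_eq τ

variable {P} in
theorem unitChord_shift (τ : ℤ) :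
    P.UnitChord (i + τ * P.n) (j + τ * P.n) ↔ P.UnitChord i j := by
  simp only [UnitChord, P.L_shift, add_lt_add_iff_right]

theorem skeletal_shift (k τ : ℤ) : P.Skeletal (k + τ * P.n) ↔ P.Skeletal k := by
  constructor
  · intro h i j hij hik
    simpa using h ((unitChord_shift τ).2 hij) (by lia)
  · intro h i j hij hik
    have := h (i := i - τ * P.n) (j := j - τ * P.n) ((unitChord_shift τ).1 (by simpa using hij))
      (by lia)
    lia

theorem skeletal_periodic : Function.Periodic P.Skeletal (P.n : ℤ) := fun k =>
  propext (by simpa using P.skeletal_shift k 1)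

variable {P} in
theorem le_add_period (h : P.UnitChord i j) : j ≤ i + P.n := by
  by_contra! hlt
  have hn := P.n_pos
  have hshift : P.UnitChord (i + P.n) (j + P.n) := by simpa using (unitChord_shift 1).2 h
  have := h.noncrossing hshift (by lia) hlt
  lia

theorem exists_skeletal : ∃ k, P.Skeletal k := by
  obtain ⟨l, ⟨i, hi⟩, hmax⟩ :=
    Int.exists_greatest_of_bdd (P := fun l => ∃ i, P.UnitChord i (i + l))
      ⟨P.n, fun l ⟨i, hi⟩ => by simpa using le_add_period hi⟩ ⟨1, 0, P.unitChord_succ 0⟩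
  refine ⟨i, fun i' j' h hi' => ?_⟩
  have hle : j' - i' ≤ l := hmax (j' - i') ⟨i', by simpa using h⟩
  by_contra! hj'
  exact absurd (h.noncrossing hi hi' hj') (by lia)

theorem exists_skeletal_gt (k : ℤ) : ∃ s, k < s ∧ P.Skeletal s := by
  obtain ⟨s, hs⟩ := P.exists_skeletal
  obtain ⟨t, ht, hst⟩ := P.skeletal_periodic.exists_mem_Ioc (mod_cast P.n_pos) s k
  exact ⟨t, ht.1, hst ▸ hs⟩

theorem exists_skeletal_lt (k : ℤ) : ∃ s, s < k ∧ P.Skeletal s := by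
  obtain ⟨s, hs⟩ := P.exists_skeletal
  obtain ⟨t, ht, hst⟩ := P.skeletal_periodic.exists_mem_Ico (mod_cast P.n_pos) s (k - P.n)
  exact ⟨t, by simpa using ht.2, hst ▸ hs⟩

/-- The last neighbour of a vertex to the right. -/
noncomputable def last (k : ℤ) : ℤ := sSup {j | P.UnitChord k j}

/-- The last neighbour of a vertex to the left. -/
noncomputable def first (k : ℤ) : ℤ := sInf {i | P.UnitChord i k}

theorem bddAbove_unitChord (k : ℤ) : BddAbove {j | P.UnitChord k j} :=
  ⟨k + P.n, fun _ h => le_add_period h⟩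

theorem bddBelow_unitChord (k : ℤ) : BddBelow {i | P.UnitChord i k} :=
  ⟨k - P.n, fun _ h => sub_le_iff_le_add.2 (le_add_period h)⟩

theorem unitChord_last (k : ℤ) : P.UnitChord k (P.last k) :=
  Int.csSup_mem ⟨_, P.unitChord_succ k⟩ (P.bddAbove_unitChord k)

theorem unitChord_first (k : ℤ) : P.UnitChord (P.first k) k :=
  Int.csInf_mem ⟨_, P.unitChord_pred k⟩ (P.bddBelow_unitChord k)

variable {P}

theorem le_last (h : P.UnitChord k j) : j ≤ P.last k :=
  le_csSup (P.bddAbove_unitChord k) h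

theorem first_le (h : P.UnitChord i k) : P.first k ≤ i :=
  csInf_le (P.bddBelow_unitChord k) h

variable (P)

theorem last_add_period (k : ℤ) : P.last (k + P.n) = P.last k + P.n := by
  apply le_antisymm
  · refine sub_le_iff_le_add.1 (le_last ((unitChord_shift 1).1 ?_))
    simpa using P.unitChord_last (k + P.n)
  · refine le_last ?_
    simpa using (unitChord_shift 1).2 (P.unitChord_last k)

theorem first_add_period (k : ℤ) : P.first (k + P.n) = P.first k + P.n := by
  apply le_antisymm
  · refine first_le ?_
    simpa using (unitChord_shift 1).2 (P.unitChord_first k)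
  · refine le_sub_iff_add_le.1 (first_le ((unitChord_shift 1).1 ?_))
    simpa using P.unitChord_first (k + P.n)

/-- The number of triangles between the first and the last neighbour of a vertex, those which are
not cut off by chords with label `1`. -/
noncomputable def gap (k : ℤ) : ℤ := P.L (P.first k) (P.last k)

theorem gap_pos (k : ℤ) : 0 < P.gap k :=
  P.L_pos ((P.unitChord_first k).1.trans (P.unitChord_last k).1)

theorem label_first (k : ℤ) : P.label k (P.first k) = P.label k (P.last k) + P.gap k := by
  have h := label_sub_label (P.unitChord_first k).L_sq_left (P.unitChord_last k).L_sq_right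
  rw [P.antisymm (P.first k) k, (P.unitChord_first k).2, (P.unitChord_last k).2] at h
  rw [gap]
  lia

theorem gap_add_period (k : ℤ) : P.gap (k + P.n) = P.gap k := by
  rw [gap, gap, first_add_period, last_add_period, P.L_add_period]

variable {P}

theorem two_le_gap (hk : P.Skeletal k) : 2 ≤ P.gap k := by
  have hpos := P.gap_pos k
  have hfirst := P.unitChord_first k
  have hlast := P.unitChord_last k
  have hne : P.gap k ≠ 1 := fun h =>
    UnitChord.not_skeletal ⟨hfirst.1.trans hlast.1, h⟩ hfirst.1 hlast.1 hk
  lia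

theorem gap_eq_one (hk : ¬ P.Skeletal k) : P.gap k = 1 := by
  obtain ⟨i, j, hij, hik, hkj⟩ := exists_unit_triangle_over hk
  have hlast : P.last k = j :=
    (hij.noncrossing (P.unitChord_last k) hik.1 hkj.1).antisymm (le_last hkj)
  have hfirst : P.first k = i := by
    refine (first_le hik).antisymm ?_
    by_contra! hlt
    exact absurd ((P.unitChord_first k).noncrossing hij hlt hik.1) hkj.1.not_ge
  rw [gap, hlast, hfirst, hij.2]

theorem not_skeletal_of_lt_last (hkj : k < j) (hj : j < P.last k) : ¬ P.Skeletal j :=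
  (P.unitChord_last k).not_skeletal hkj hj

theorem not_skeletal_of_first_lt (hj : P.first k < j) (hjk : j < k) : ¬ P.Skeletal j :=
  (P.unitChord_first k).not_skeletal hj hjk

theorem skeletal_last (hk : P.Skeletal k) : P.Skeletal (P.last k) := fun i j h hi => by
  rcases lt_trichotomy i k with hik | rfl | hki
  · exact (hk h hik).trans (P.unitChord_last k).1.le
  · exact le_last h
  · exact (P.unitChord_last k).noncrossing h hki hi

theorem skeletal_first (hk : P.Skeletal k) : P.Skeletal (P.first k) := fun i j h hi => by
  by_contra! hj
  rcases lt_trichotomy k j with hkj | rfl | hjk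
  · exact hkj.not_ge (hk h (hi.trans (P.unitChord_first k).1))
  · exact hi.not_ge (first_le h)
  · exact hjk.not_ge (h.noncrossing (P.unitChord_first k) hi hj)

variable (P)

open Classical in
/-- The number of triangles at an outer vertex that have an edge on the inner boundary. -/
noncomputable def weight (k : ℤ) : ℤ := if P.Skeletal k then P.gap k - 2 else 0

theorem weight_nonneg (k : ℤ) : 0 ≤ P.weight k := by
  unfold weight
  split_ifs with h
  · exact sub_nonneg.2 (two_le_gap h)
  · rfl

theorem weight_add_period (k : ℤ) : P.weight (k + P.n) = P.weight k := by
  rw [weight, weight, P.gap_add_period, show P.Skeletal (k + P.n) = P.Skeletal k from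
    P.skeletal_periodic k]

/-- The sum of the weights of all vertices before `k`, normalised to vanish at `0`. The bridging
arcs at a skeletal vertex `k` end in the inner vertices from `height k` to `height (k + 1)`. -/
noncomputable def height (k : ℤ) : ℤ := evolve (fun i => Equiv.addRight (P.weight i)) 0 k

@[simp] theorem height_zero : P.height 0 = 0 := evolve_zero ..

theorem height_succ (k : ℤ) : P.height (k + 1) = P.height k + P.weight k := evolve_add_one ..

theorem height_mono : Monotone P.height :=
  monotone_int_of_le_succ fun k => by simpa [height_succ] using P.weight_nonneg k

/-- The number of marked points needed on the inner boundary. -/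
noncomputable def total : ℕ := (P.height P.n).toNat

theorem coe_total : (P.total : ℤ) = P.height P.n :=
  Int.toNat_of_nonneg (P.height_zero ▸ P.height_mono (Int.natCast_nonneg _))

theorem height_add_period (k : ℤ) : P.height (k + P.n) = P.height k + P.total := by
  have h : Function.Periodic (fun k => P.height (k + P.n) - P.height k) 1 := fun k => by
    simp only
    rw [add_right_comm, height_succ, height_succ, weight_add_period]
    ring
  have := h.int_mul_eq k
  simp only [mul_one, zero_add, height_zero, ← coe_total, Int.cast_id] at this
  lia

theorem height_shift (k τ : ℤ) : P.height (k + τ * P.n) = P.height k + τ * P.total := by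
  have h : Function.Periodic (fun τ : ℤ => P.height (k + τ * P.n) - τ * P.total) 1 := fun τ => by
    simp only
    rw [add_mul, one_mul, ← add_assoc, height_add_period]
    ring
  have := h.int_mul_eq τ
  simp only [mul_one, zero_mul, add_zero, Int.cast_id] at this
  lia

variable {P}

theorem weight_eq_zero (h : P.total = 0) (k : ℤ) : P.weight k = 0 := by
  have hmono := P.height_mono (show k + 1 ≤ k + P.n by have := P.n_pos; lia)
  rw [height_add_period, height_succ, h] at hmono
  have := P.weight_nonneg k
  lia

theorem height_eq_of_not_skeletal (hij : i ≤ j) (h : ∀ k, i ≤ k → k < j → ¬ P.Skeletal k) :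
    P.height j = P.height i := by
  induction j, hij using Int.leInduction with
  | base => rfl
  | succ j hij ih =>
    rw [height_succ, ih fun k hik hkj => h k hik (by lia), weight, if_neg (h j hij (by lia)),
      add_zero]

theorem exists_skeletal_of_lt_height (h : l < P.height k) :
    ∃ s, s < k ∧ P.Skeletal s ∧ l < P.height (s + 1) := by
  obtain ⟨s, ⟨hsk, hs⟩, hmax⟩ := Int.exists_greatest_of_bdd (P := fun s => s < k ∧ P.Skeletal s)
    ⟨k, fun z hz => hz.1.le⟩ (P.exists_skeletal_lt k)
  refine ⟨s, hsk, hs, ?_⟩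
  rwa [← height_eq_of_not_skeletal (show s + 1 ≤ k from hsk)]
  exact fun z hsz hzk hz => absurd (hmax z ⟨hzk, hz⟩) (by lia)

theorem exists_skeletal_of_height_lt (h : P.height (k + 1) < l) :
    ∃ s, k < s ∧ P.Skeletal s ∧ P.height s < l := by
  obtain ⟨s, ⟨hks, hs⟩, hmin⟩ := Int.exists_least_of_bdd (P := fun s => k < s ∧ P.Skeletal s)
    ⟨k, fun z hz => hz.1.le⟩ (P.exists_skeletal_gt k)
  refine ⟨s, hks, hs, ?_⟩
  rwa [height_eq_of_not_skeletal (show k + 1 ≤ s from hks)]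
  exact fun z hkz hzs hz => absurd (hmin z ⟨by lia, hz⟩) (by lia)

theorem exists_skeletal_height (h : 0 < P.total) (l : ℤ) :
    ∃ k, P.Skeletal k ∧ P.height k ≤ l ∧ l ≤ P.height (k + 1) := by
  have height_mul (τ : ℤ) : P.height (τ * P.n) = τ * P.total := by
    simpa using P.height_shift 0 τ
  obtain ⟨k, hk, hmax⟩ := Int.exists_greatest_of_bdd (P := fun k => P.height k ≤ l)
    ⟨(|l| + 1) * P.n, fun z hz => by
      by_contra! hlt
      have := P.height_mono hlt.le
      rw [height_mul] at this
      nlinarith [le_abs_self l, abs_nonneg l]⟩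
    ⟨-|l| * P.n, by
      rw [height_mul]
      nlinarith [neg_abs_le l, abs_nonneg l]⟩
  have hlt : l < P.height (k + 1) := by
    by_contra! hle
    exact absurd (hmax (k + 1) hle) (by lia)
  refine ⟨k, ?_, hk, hlt.le⟩
  by_contra hsk
  rw [height_succ, weight, if_neg hsk] at hlt
  lia

theorem label_le_label_last (h : P.UnitChord k j) : P.label k j ≤ P.label k (P.last k) := by
  have hsub := label_sub_label h.L_sq_right (P.unitChord_last k).L_sq_right
  rw [h.2, (P.unitChord_last k).2] at hsub
  have := P.L_nonneg (le_last h)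
  lia

theorem label_first_le_label (h : P.UnitChord i k) : P.label k (P.first k) ≤ P.label k i := by
  have hsub := label_sub_label (P.unitChord_first k).L_sq_left h.L_sq_left
  rw [P.antisymm i k, P.antisymm (P.first k) k, h.2, (P.unitChord_first k).2] at hsub
  have := P.L_nonneg (first_le h)
  lia

theorem label_le_label_pred (h : P.UnitChord i k) : P.label k i ≤ P.L (k - 1) (k + 1) := by
  have hsub := label_sub_label h.L_sq_left (P.unitChord_pred k).L_sq_left
  rw [P.antisymm i k, P.antisymm (k - 1) k, h.2, (P.unitChord_pred k).2, label_pred] at hsub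
  have := P.L_nonneg (show i ≤ k - 1 from Int.le_sub_one_of_lt h.1)
  lia

theorem label_eq_label_last_iff (h : P.UnitChord k j) :
    P.label k j = P.label k (P.last k) ↔ j = P.last k :=
  ⟨eq_of_label_eq h.L_sq_right (P.unitChord_last k).L_sq_right, congrArg _⟩

theorem label_eq_label_first_iff (h : P.UnitChord i k) :
    P.label k i = P.label k (P.first k) ↔ i = P.first k :=
  ⟨eq_of_label_eq h.L_sq_left (P.unitChord_first k).L_sq_left, congrArg _⟩

theorem skeletal_right_iff (hk : P.Skeletal k) (h : P.UnitChord k j) :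
    P.Skeletal j ↔ j = P.last k := by
  refine ⟨fun hj => ?_, fun hj => hj ▸ skeletal_last hk⟩
  by_contra hne
  exact not_skeletal_of_lt_last h.1 ((le_last h).lt_of_ne hne) hj

theorem skeletal_left_iff (hk : P.Skeletal k) (h : P.UnitChord i k) :
    P.Skeletal i ↔ i = P.first k := by
  refine ⟨fun hi => ?_, fun hi => hi ▸ skeletal_first hk⟩
  by_contra hne
  exact not_skeletal_of_first_lt ((first_le h).lt_of_ne' hne) h.1 hi

variable (P)

theorem height_last (k : ℤ) : P.height (P.last k) = P.height (k + 1) :=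
  height_eq_of_not_skeletal (P.unitChord_last k).1 fun _ hj hj' =>
    not_skeletal_of_lt_last hj hj'

theorem height_first_add_one (k : ℤ) : P.height (P.first k + 1) = P.height k :=
  (height_eq_of_not_skeletal (P.unitChord_first k).1 fun _ hj hj' =>
    not_skeletal_of_first_lt hj hj').symm

variable {P}

theorem label_first_of_skeletal (hk : P.Skeletal k) :
    P.label k (P.first k) = P.label k (P.last k) + 2 + (P.height (k + 1) - P.height k) := by
  rw [label_first, height_succ, weight, if_pos hk]
  ring

theorem height_add_one_of_total (h : P.total = 0) (k : ℤ) : P.height (k + 1) = P.height k := by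
  rw [height_succ, weight_eq_zero h, add_zero]

end PeriodicPattern

namespace Frieze

variable {F : Frieze} {n : ℕ} {a : Fin n → ℕ} {i j : ℤ}

/-- The entry of the frieze at the chord from vertex `i` to vertex `j`. -/
def chord (F : Frieze) (i j : ℤ) : ℤ := F.entry (i + 2) j

theorem chord_self (i : ℤ) : F.chord i i = 0 := by
  simpa [chord] using F.top_zero (i + 2)

theorem chord_succ (i : ℤ) : F.chord i (i + 1) = 1 := by
  have := F.top_one (i + 2)
  rwa [show i + 2 - 1 = i + 1 by ring] at this

theorem chord_pos (hF : F.width = ⊤) (hij : i < j) : 0 < F.chord i j := by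
  rcases eq_or_lt_of_le (show i + 1 ≤ j from hij) with rfl | h
  · rw [chord_succ]
    exact one_pos
  · obtain ⟨k, hk⟩ := Int.eq_ofNat_of_zero_le (show 0 ≤ j - (i + 2) by lia)
    obtain rfl : j = i + 2 + k := by lia
    exact F.pos (i + 2) k (hF ▸ ENat.natCast_lt_top k)

theorem chord_unimodular (hF : F.width = ⊤) (hij : i < j) :
    F.chord i j * F.chord (i + 1) (j + 1) - F.chord (i + 1) j * F.chord i (j + 1) = 1 := by
  obtain ⟨k, hk⟩ := Int.eq_ofNat_of_zero_le (show 0 ≤ j - (i + 1) by lia)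
  obtain rfl : j = i + 1 + k := by lia
  have := F.unimodular (i + 2) k (by rw [hF]; simp)
  rw [show i + 2 - 1 + (k : ℤ) = i + 1 + k by ring] at this
  rw [chord, chord, chord, chord, show i + 1 + 2 = i + 2 + 1 by ring]
  exact this

/-- The quiddity row, indexed by the middle vertex of the three that a chord spans. -/
def quiddity (F : Frieze) (k : ℤ) : ℤ := F.chord (k - 1) (k + 1)

theorem chord_rec (hF : F.width = ⊤) (hij : i < j) :
    F.chord i (j + 1) = F.quiddity j * F.chord i j - F.chord i (j - 1) := by
  induction hN : (j - i).toNat generalizing i with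
  | zero => lia
  | succ N ih =>
    rcases eq_or_lt_of_le (show i ≤ j - 1 by lia) with rfl | h
    · have := F.chord_succ (j - 1)
      rw [sub_add_cancel] at this
      rw [this, chord_self, quiddity]
      ring
    · have hrec := ih (i := i + 1) (by lia) (by lia)
      have hdiamond := chord_unimodular hF hij
      have hdiamond' := chord_unimodular hF h
      rw [sub_add_cancel] at hdiamond'
      apply mul_left_cancel₀ (chord_pos hF (show i + 1 < j by lia)).ne'
      rw [hrec] at hdiamond
      linear_combination hdiamond' - hdiamond

/-- The matrix that carries the columns `v (k - 1)`, `v k` to `v k`, `v (k + 1)`, for every solution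
of the recursion `v (k + 1) = quiddity k • v k - v (k - 1)`. -/
def transferMatrix (F : Frieze) (k : ℤ) : Matrix.SpecialLinearGroup (Fin 2) ℤ :=
  ⟨!![0, -1; 1, F.quiddity k], by rw [Matrix.det_fin_two_of]; ring⟩

/-- The matrix with columns `v k` and `v (k + 1)`, where the vectors `v k` form the fundamental
solution of the recursion `v (k + 1) = quiddity k • v k - v (k - 1)`. -/
def fundamentalMatrix (F : Frieze) (k : ℤ) : Matrix.SpecialLinearGroup (Fin 2) ℤ :=
  evolve (fun i => Equiv.mulRight (F.transferMatrix (i + 1))) 1 k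

theorem fundamentalMatrix_succ (k : ℤ) :
    F.fundamentalMatrix (k + 1) = F.fundamentalMatrix k * F.transferMatrix (k + 1) :=
  evolve_add_one ..

theorem fundamentalMatrix_succ_left (r : Fin 2) (k : ℤ) :
    F.fundamentalMatrix (k + 1) r 0 = F.fundamentalMatrix k r 1 := by
  rw [fundamentalMatrix_succ, Matrix.SpecialLinearGroup.coe_mul]
  simp [transferMatrix, Matrix.mul_apply]

theorem fundamentalMatrix_rec (r : Fin 2) (k : ℤ) :
    F.fundamentalMatrix (k + 1) r 0
      = F.quiddity k * F.fundamentalMatrix k r 0 - F.fundamentalMatrix (k - 1) r 0 := by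
  obtain ⟨k, rfl⟩ : ∃ l, k = l + 1 := ⟨k - 1, by ring⟩
  rw [fundamentalMatrix_succ_left, fundamentalMatrix_succ_left, add_sub_cancel_right,
    fundamentalMatrix_succ, Matrix.SpecialLinearGroup.coe_mul]
  simp [transferMatrix, Matrix.mul_apply]
  ring

/-- The determinant of two vectors of the fundamental solution; for `i ≤ j` it is the entry of the
frieze at the chord from `i` to `j`. -/
def bracket (F : Frieze) (i j : ℤ) : ℤ :=
  F.fundamentalMatrix i 0 0 * F.fundamentalMatrix j 1 0
    - F.fundamentalMatrix j 0 0 * F.fundamentalMatrix i 1 0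

theorem bracket_antisymm (i j : ℤ) : F.bracket j i = -F.bracket i j := by
  rw [bracket, bracket]
  ring

theorem bracket_self (i : ℤ) : F.bracket i i = 0 := sub_self _

theorem bracket_succ (i : ℤ) : F.bracket i (i + 1) = 1 := by
  rw [bracket, fundamentalMatrix_succ_left, fundamentalMatrix_succ_left, ← Matrix.det_fin_two]
  exact (F.fundamentalMatrix i).det_coe

theorem bracket_rec (i j : ℤ) :
    F.bracket i (j + 1) = F.quiddity j * F.bracket i j - F.bracket i (j - 1) := by
  rw [bracket, fundamentalMatrix_rec, fundamentalMatrix_rec, bracket, bracket]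
  ring

theorem eq_of_rec {R : Type*} [Ring R] {c x y : ℤ → R}
    (hx : ∀ k, i < k → x (k + 1) = c k * x k - x (k - 1))
    (hy : ∀ k, i < k → y (k + 1) = c k * y k - y (k - 1))
    (h : x i = y i) (h' : x (i + 1) = y (i + 1)) (hij : i ≤ j) : x j = y j := by
  suffices H : x j = y j ∧ x (j + 1) = y (j + 1) from H.1
  induction j, hij using Int.leInduction with
  | base => exact ⟨h, h'⟩
  | succ j hij ih =>
    refine ⟨ih.2, ?_⟩
    rw [hx _ (by lia), hy _ (by lia), add_sub_cancel_right, ih.1, ih.2]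

theorem chord_eq_bracket (hF : F.width = ⊤) (hij : i ≤ j) : F.chord i j = F.bracket i j :=
  eq_of_rec (fun _ => chord_rec hF) (fun k _ => bracket_rec i k)
    (by rw [chord_self, bracket_self]) (by rw [chord_succ, bracket_succ]) hij

theorem HasQuidditySequence.quiddity_eq (h : F.HasQuidditySequence a) (i : Fin n) (k : ℤ) :
    F.quiddity (i + k * n) = a i := by
  rw [← h i k, quiddity, chord]
  congr 1 <;> ring

theorem HasQuidditySequence.quiddity_periodic (h : F.HasQuidditySequence a) (hn : 0 < n) :
    Function.Periodic F.quiddity n := fun k => by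
  obtain ⟨i, hi⟩ : ∃ i : Fin n, (i : ℤ) = k % n := by
    have hpos : (0 : ℤ) < n := mod_cast hn
    have hnonneg := Int.emod_nonneg k hpos.ne'
    exact ⟨⟨(k % n).toNat, by have := Int.emod_lt_of_pos k hpos; lia⟩, Int.toNat_of_nonneg hnonneg⟩
  have hk : k = i + k / n * n := by rw [hi, Int.emod_add_ediv_mul]
  rw [hk, add_assoc, ← add_one_mul, h.quiddity_eq, h.quiddity_eq]

theorem bracket_add_period (hc : Function.Periodic F.quiddity n) (i j : ℤ) :
    F.bracket (i + n) (j + n) = F.bracket i j := by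
  have of_le {i j : ℤ} (hij : i ≤ j) : F.bracket (i + n) (j + n) = F.bracket i j := by
    refine eq_of_rec (x := fun j => F.bracket (i + n) (j + n)) (fun k _ => ?_)
      (fun k _ => bracket_rec i k) (by simp only [bracket_self])
      (by simp only [add_right_comm, bracket_succ]) hij
    rw [add_right_comm, bracket_rec, hc, sub_add_eq_add_sub]
  rcases le_total i j with hij | hji
  · exact of_le hij
  · rw [bracket_antisymm (j + n), of_le hji, ← bracket_antisymm]

/-- The pattern of an infinite periodic frieze. -/
def pattern (F : Frieze) (hF : F.width = ⊤) (hn : 0 < n) (h : F.HasQuidditySequence a) :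
    PeriodicPattern where
  L := F.bracket
  antisymm := bracket_antisymm
  L_succ := bracket_succ
  L_pos hij := chord_eq_bracket hF hij.le ▸ chord_pos hF hij
  ptolemy i j k l := by
    simp only [bracket]
    ring
  n := n
  n_pos := hn
  L_add_period := bracket_add_period (h.quiddity_periodic hn)

theorem HasQuidditySequence.bracket_eq (h : F.HasQuidditySequence a) (hF : F.width = ⊤)
    (i : Fin n) : F.bracket (i - 1) (i + 1) = a i := by
  rw [← chord_eq_bracket hF (by lia)]
  simpa [quiddity] using h.quiddity_eq i 0

end Frieze

namespace AnnulusTriangulation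

open Complex ComplexConjugate unitInterval

/-! ### Paths in a disc with linked endpoints meet -/

theorem one_sub_mem_slitPlane {w : ℂ} (hw : ‖w‖ ≤ 1) (h : w ≠ 1) : 1 - w ∈ slitPlane := by
  by_cases him : w.im = 0
  · have hre : w.re ≠ 1 := fun hre => h (Complex.ext hre him)
    exact Or.inl (by simpa using lt_of_le_of_ne ((re_le_norm w).trans hw) hre)
  · exact Or.inr (by simpa using him)

theorem arg_one_sub_inv {w : ℂ} (hw : ‖w‖ = 1) : arg (1 - w⁻¹) = -arg (1 - w) := by
  have hconj : 1 - w⁻¹ = conj (1 - w) := by rw [inv_eq_conj hw, map_sub, map_one]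
  have hre : 0 ≤ (1 - w).re := by simpa [hw] using re_le_norm w
  rw [hconj, arg_conj, if_neg fun hpi => hre.not_gt (arg_eq_pi_iff.1 hpi).1]

theorem arg_one_sub_div_comm {z w : ℂ} (hz : ‖z‖ = 1) (hw : ‖w‖ = 1) :
    arg (1 - z / w) = -arg (1 - w / z) := by
  rw [← inv_div, arg_one_sub_inv (by rw [norm_div, hz, hw, div_one])]

theorem exists_continuous_log (F : C(I × I, ℂ)) (hF : ∀ z, F z ≠ 0) :
    ∃ l : C(I × I, ℂ), ∀ z, exp (l z) = F z := by
  let G : C(ℝ × ℝ, ℂ) := F.comp ⟨fun z => (Set.projIcc 0 1 zero_le_one z.1,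
    Set.projIcc 0 1 zero_le_one z.2), by fun_prop⟩
  obtain ⟨l, ⟨-, hl⟩, -⟩ := isCoveringMapOn_exp.existsUnique_continuousMap_lifts G (a₀ := 0)
    (exp_log (x := G 0) (hF _)) (fun _ => hF _)
  refine ⟨l.comp ⟨fun z => ((z.1 : ℝ), (z.2 : ℝ)), by fun_prop⟩, fun z => ?_⟩
  simpa [G] using congrFun hl ((z.1 : ℝ), (z.2 : ℝ))

/-- Seen from a point `P` of the unit circle, the closed unit disc lies in a half-plane, so the
principal logarithm measures the change of argument. -/
theorem continuous_log_change {P c : ℂ} (hP : ‖P‖ = 1) (hc : c ≠ 0) {h l : C(I, ℂ)}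
    (hle : ∀ t, ‖h t‖ ≤ 1) (hne : ∀ t, h t ≠ P) (hexp : ∀ t, exp (l t) = c * (P - h t)) :
    l 1 - l 0 = log (1 - h 1 / P) - log (1 - h 0 / P) := by
  have hP0 : P ≠ 0 := norm_ne_zero_iff.1 (by rw [hP]; exact one_ne_zero)
  have hslit (t) : 1 - h t / P ∈ slitPlane :=
    one_sub_mem_slitPlane (by rw [norm_div, hP, div_one]; exact hle t)
      fun H => hne t ((div_eq_one_iff_eq hP0).1 H)
  have hcont : Continuous fun t => l t - log (1 - h t / P) :=
    l.continuous.sub (Continuous.clog (by fun_prop) hslit)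
  have hconst (t) : exp (l t - log (1 - h t / P)) = c * P := by
    rw [exp_sub, hexp, exp_log (slitPlane_ne_zero (hslit t)),
      div_eq_iff (slitPlane_ne_zero (hslit t))]
    field_simp
  have := isCoveringMap_exp.const_of_comp hcont
    (fun _ _ => Subtype.ext (by simp only [hconst])) 1 0
  linear_combination this

theorem sum_arg_eq_zero_of_disjoint {f g : C(I, ℂ)} (hf : ∀ t, ‖f t‖ ≤ 1) (hg : ∀ t, ‖g t‖ ≤ 1)
    (hf0 : ‖f 0‖ = 1) (hf1 : ‖f 1‖ = 1) (hg0 : ‖g 0‖ = 1) (hg1 : ‖g 1‖ = 1)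
    (hne : ∀ x y, f x ≠ g y) :
    arg (1 - g 1 / f 0) + arg (1 - f 0 / g 0) + arg (1 - g 0 / f 1) + arg (1 - f 1 / g 1) = 0 := by
  obtain ⟨l, hl⟩ := exists_continuous_log ⟨fun z => f z.1 - g z.2, by fun_prop⟩ fun z =>
    sub_ne_zero.2 (hne z.1 z.2)
  simp only [ContinuousMap.coe_mk] at hl
  have along_f (y : I) (hy : ‖g y‖ = 1) :
      l (1, y) - l (0, y) = log (1 - f 1 / g y) - log (1 - f 0 / g y) :=
    continuous_log_change hy (neg_ne_zero.2 one_ne_zero) (h := f)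
      (l := ⟨fun t => l (t, y), by fun_prop⟩) hf (hne · y) fun t => by
        simp only [ContinuousMap.coe_mk, hl]; ring
  have along_g (x : I) (hx : ‖f x‖ = 1) :
      l (x, 1) - l (x, 0) = log (1 - g 1 / f x) - log (1 - g 0 / f x) :=
    continuous_log_change hx one_ne_zero (h := g) (l := ⟨fun t => l (x, t), by fun_prop⟩) hg
      (fun t => (hne x t).symm) fun t => by simp only [ContinuousMap.coe_mk, hl, one_mul]
  have around := congrArg im (show log (1 - g 1 / f 0) - log (1 - g 0 / f 0)
      + (log (1 - f 1 / g 1) - log (1 - f 0 / g 1)) = log (1 - f 1 / g 0) - log (1 - f 0 / g 0)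
      + (log (1 - g 1 / f 1) - log (1 - g 0 / f 1)) by
    linear_combination along_f 0 hg0 + along_g 1 hf1 - along_g 0 hf0 - along_f 1 hg1)
  simp only [add_im, sub_im, log_im] at around
  linarith [arg_one_sub_div_comm hf0 hg1, arg_one_sub_div_comm hg0 hf0,
    arg_one_sub_div_comm hf1 hg0, arg_one_sub_div_comm hg1 hf1]

theorem exists_meet {f g : C(I, ℂ)} (hf : ∀ t, ‖f t‖ ≤ 1) (hg : ∀ t, ‖g t‖ ≤ 1)
    (hf0 : ‖f 0‖ = 1) (hf1 : ‖f 1‖ = 1) (hg0 : ‖g 0‖ = 1) (hg1 : ‖g 1‖ = 1) {c : ℝ} (hc : c < 0)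
    (hlinked : (1 - g 1 / f 0) * (1 - f 0 / g 0) * (1 - g 0 / f 1) * (1 - f 1 / g 1) = c) :
    ∃ x y, f x = g y := by
  by_contra! hne
  have hsum : exp (arg (1 - g 1 / f 0) * Complex.I) * exp (arg (1 - f 0 / g 0) * Complex.I) *
      exp (arg (1 - g 0 / f 1) * Complex.I) * exp (arg (1 - f 1 / g 1) * Complex.I) = 1 := by
    rw [← exp_add, ← exp_add, ← exp_add, ← add_mul, ← add_mul, ← add_mul]
    exact_mod_cast congrArg (fun θ : ℝ => exp (θ * Complex.I))
      (sum_arg_eq_zero_of_disjoint hf hg hf0 hf1 hg0 hg1 hne) |>.trans (by simp)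
  have hnonneg : c = ‖1 - g 1 / f 0‖ * ‖1 - f 0 / g 0‖ * ‖1 - g 0 / f 1‖ * ‖1 - f 1 / g 1‖ := by
    rw [← norm_mul_exp_arg_mul_I (1 - g 1 / f 0), ← norm_mul_exp_arg_mul_I (1 - f 0 / g 0),
      ← norm_mul_exp_arg_mul_I (1 - g 0 / f 1), ← norm_mul_exp_arg_mul_I (1 - f 1 / g 1)]
      at hlinked
    rw [← ofReal_inj, ← hlinked]
    push_cast
    linear_combination (‖1 - g 1 / f 0‖ * ‖1 - f 0 / g 0‖ * ‖1 - g 0 / f 1‖ * ‖1 - f 1 / g 1‖ : ℂ)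
      * hsum
  exact hc.not_ge (hnonneg ▸ by positivity)

/-! ### The strip as a hyperbolic plane -/

/-- The strip as a closed disc (the Klein model of the hyperbolic plane) without the two boundary
points `±1`, which correspond to the two ends of the strip. -/
noncomputable def disc (p : Strip) : ℂ := ⟨Real.tanh p.1, (2 * p.2 - 1) / Real.cosh p.1⟩

theorem continuous_disc : Continuous disc := by
  have hre : Continuous fun p : Strip => Real.tanh p.1 := by
    simp only [Real.tanh_eq_sinh_div_cosh]
    exact (Real.continuous_sinh.comp continuous_fst).div
      (Real.continuous_cosh.comp continuous_fst) fun p => (Real.cosh_pos _).ne'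
  have him : Continuous fun p : Strip => (2 * (p.2 : ℝ) - 1) / Real.cosh p.1 :=
    Continuous.div (by fun_prop) (by fun_prop) fun p => (Real.cosh_pos _).ne'
  exact equivRealProdCLM.symm.continuous.comp (hre.prodMk him)

theorem sq_norm_disc (p : Strip) :
    ‖disc p‖ ^ 2 = 1 - (1 - (2 * (p.2 : ℝ) - 1) ^ 2) / Real.cosh p.1 ^ 2 := by
  have := Real.cosh_pos p.1
  rw [← normSq_eq_norm_sq, normSq_apply, disc, Real.tanh_eq_sinh_div_cosh]
  field_simp
  linear_combination -Real.cosh_sq p.1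

theorem norm_disc_le (p : Strip) : ‖disc p‖ ≤ 1 := by
  have : 0 ≤ (1 - (2 * (p.2 : ℝ) - 1) ^ 2) / Real.cosh p.1 ^ 2 :=
    div_nonneg (by nlinarith [p.2.2.1, p.2.2.2]) (sq_nonneg _)
  exact (sq_le_one_iff₀ (norm_nonneg _)).1 (by linarith [sq_norm_disc p])

theorem norm_disc_lt_one_iff {p : Strip} : ‖disc p‖ < 1 ↔ p.2 ∈ Set.Ioo (0 : I) 1 := by
  have hcosh := pow_pos (Real.cosh_pos p.1) 2
  rw [← sq_lt_one_iff₀ (norm_nonneg _), sq_norm_disc, sub_lt_self_iff,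
    div_pos_iff_of_pos_right hcosh]
  constructor
  · intro h
    exact ⟨show (0 : ℝ) < p.2 by nlinarith [p.2.2.1], show (p.2 : ℝ) < 1 by nlinarith [p.2.2.2]⟩
  · rintro ⟨h0 : (0 : ℝ) < p.2, h1 : (p.2 : ℝ) < 1⟩
    nlinarith

theorem disc_injective : Function.Injective disc := by
  intro p q h
  obtain ⟨hre, him⟩ := Complex.mk.inj h
  have hx : p.1 = q.1 := Real.tanh_injective hre
  rw [hx, div_left_inj' (Real.cosh_pos _).ne'] at him
  exact Prod.ext hx (Subtype.ext (by linarith))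

/-- The point of the unit circle with homogeneous coordinates `(z.re, z.im)`. -/
noncomputable def ideal (z : ℂ) : ℂ := conj z / z

theorem norm_ideal {z : ℂ} (hz : z ≠ 0) : ‖ideal z‖ = 1 := by
  rw [ideal, norm_div, norm_conj, div_self (norm_ne_zero_iff.2 hz)]

/-- The determinant of two vectors in the plane. -/
def det (z w : ℂ) : ℝ := z.re * w.im - z.im * w.re

theorem det_swap (z w : ℂ) : det w z = -det z w := by simp only [det]; ring

theorem one_sub_ideal_div {x y : ℂ} (hx : x ≠ 0) (hy : y ≠ 0) :
    1 - ideal x / ideal y = 2 * Complex.I * det y x / (x * conj y) := by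
  have : conj x ≠ 0 := (map_ne_zero _).2 hx
  have hy' : conj y ≠ 0 := (map_ne_zero _).2 hy
  have hdet : x * conj y - conj x * y = 2 * Complex.I * det y x := by
    apply Complex.ext
    · simp [det, mul_comm]
    · simp [det]
      ring
  rw [← hdet, ideal, ideal]
  field_simp

theorem det_eq_zero_of_ideal_eq {x y : ℂ} (hx : x ≠ 0) (hy : y ≠ 0) (h : ideal x = ideal y) :
    det x y = 0 := by
  have hy1 : ideal y ≠ 0 := norm_ne_zero_iff.1 (by rw [norm_ideal hy]; exact one_ne_zero)
  have := one_sub_ideal_div hx hy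
  rw [h, div_self hy1, sub_self, eq_comm, div_eq_zero_iff, or_iff_left (by simp [hx, hy])] at this
  rw [det_swap]
  simpa using this

theorem prod_one_sub_ideal_div {u v r s : ℂ} (hu : u ≠ 0) (hv : v ≠ 0) (hr : r ≠ 0) (hs : s ≠ 0) :
    (1 - ideal s / ideal u) * (1 - ideal u / ideal r) * (1 - ideal r / ideal v) *
      (1 - ideal v / ideal s) = ((16 * (det u r * det v r * det u s * det v s) /
        (normSq u * normSq v * normSq r * normSq s) : ℝ) : ℂ) := by
  rw [one_sub_ideal_div hs hu, one_sub_ideal_div hu hr, one_sub_ideal_div hr hv,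
    one_sub_ideal_div hv hs, det_swap u r, det_swap v s]
  push_cast
  simp only [← mul_conj, div_mul_div_comm]
  congr 1
  · linear_combination 16 * (det u s * det u r * det v r * det v s : ℂ) * I_pow_four
  · ring

/-! ### Vertices as points of the unit circle -/

/-- Homogeneous coordinates of the point of the unit circle at a vertex. -/
noncomputable def homog (n m : ℕ) : Vertex → ℂ
  | .outer k => ⟨Real.exp ((k : ℝ) / n / 2), Real.exp (-((k : ℝ) / n / 2))⟩
  | .inner k => ⟨-Real.exp ((k : ℝ) / m / 2), Real.exp (-((k : ℝ) / m / 2))⟩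
  | .limit .right => ⟨1, 0⟩
  | .limit .left => ⟨0, 1⟩

theorem homog_ne_zero (n m : ℕ) (u : Vertex) : homog n m u ≠ 0 := by
  rcases u with k | k | (_ | _) <;> simp [homog, Complex.ext_iff, Real.exp_ne_zero]

/-- The position of a vertex in the strip; the value at the limit points is junk. -/
noncomputable def position (n m : ℕ) : Vertex → Strip
  | .outer k => outerPoint n k
  | .inner k => innerPoint m k
  | .limit _ => (0, 0)

/-- The vertex is a marked point of the strip: not a limit point, and on the upper boundary only if
there are marked points on the inner boundary circle. -/
def Vertex.IsMarked (m : ℕ) : Vertex → Prop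
  | .outer _ => True
  | .inner _ => 0 < m
  | .limit _ => False

theorem ideal_exp (x : ℝ) :
    ideal ⟨Real.exp (x / 2), Real.exp (-(x / 2))⟩ = ⟨Real.tanh x, -(1 / Real.cosh x)⟩ := by
  set a := Real.exp (x / 2) with ha
  set b := Real.exp (-(x / 2)) with hb
  have hab : a * b = 1 := by rw [ha, hb, ← Real.exp_add, add_neg_cancel, Real.exp_zero]
  have hexp : Real.exp x = a ^ 2 := by rw [ha, ← Real.exp_nat_mul]; congr 1; push_cast; ring
  have hexp' : Real.exp (-x) = b ^ 2 := by rw [hb, ← Real.exp_nat_mul]; congr 1; push_cast; ring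
  have ha0 : 0 < a := Real.exp_pos _
  rw [ideal, div_eq_iff (by simp [Complex.ext_iff, ha0.ne'])]
  apply Complex.ext <;>
    simp only [conj_re, conj_im, mul_re, mul_im, Real.tanh_eq_sinh_div_cosh, Real.sinh_eq,
      Real.cosh_eq, hexp, hexp'] <;> field_simp
  · linear_combination 2 * b * hab
  · linear_combination -2 * a * hab

theorem ideal_neg_conj (z : ℂ) : ideal (-conj z) = conj (ideal z) := by
  simp [ideal]

theorem disc_position (n m : ℕ) {u : Vertex} (hu : u.IsMarked m) :
    disc (position n m u) = ideal (homog n m u) := by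
  rcases u with k | k | d
  · rw [homog, ideal_exp]
    exact Complex.ext rfl (by simp [disc, position, outerPoint, neg_div])
  · have hconj : homog n m (.inner k) = -conj ⟨Real.exp ((k : ℝ) / m / 2),
        Real.exp (-((k : ℝ) / m / 2))⟩ := Complex.ext (by simp [homog]) (by simp [homog])
    rw [hconj, ideal_neg_conj, ideal_exp]
    exact Complex.ext rfl (by norm_num [disc, position, innerPoint])
  · exact hu.elim

/-! ### Crossing chords -/

/-- The vertex can occur in `A_{n,m}` with `n > 0`: inner vertices need marked points on the inner
boundary. -/
def Valid (m : ℕ) : Vertex → Prop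
  | .inner _ => 0 < m
  | _ => True

theorem Vertex.IsMarked.valid {m : ℕ} {u : Vertex} (hu : u.IsMarked m) : Valid m u := by
  cases u <;> first | exact hu | trivial

/-- An integer with the sign of the determinant of the coordinates of two vertices, which records
their cyclic order on the boundary of the strip cut open at the left limit point. -/
def order : Vertex → Vertex → ℤ
  | .outer k, .outer l => k - l
  | .outer _, .inner _ => 1
  | .outer _, .limit .right => -1
  | .outer _, .limit .left => 1
  | .inner _, .outer _ => -1
  | .inner k, .inner l => l - k
  | .inner _, .limit _ => -1
  | .limit .right, .outer _ => 1
  | .limit .left, .outer _ => -1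
  | .limit _, .inner _ => 1
  | .limit .right, .limit .left => 1
  | .limit .left, .limit .right => -1
  | .limit .right, .limit .right => 0
  | .limit .left, .limit .left => 0

/-- The chords `u v` and `r s` cross: `r` and `s` are separated by `u` and `v`. -/
def Crosses (u v r s : Vertex) : Prop := order u r * order v r * order u s * order v s < 0

theorem sign_det_exp (a b : ℤ) {n : ℕ} (hn : 0 < n) :
    SignType.sign (Real.exp ((a : ℝ) / n / 2) * Real.exp (-((b : ℝ) / n / 2)) -
      Real.exp (-((a : ℝ) / n / 2)) * Real.exp ((b : ℝ) / n / 2)) = SignType.sign (a - b) := by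
  have : (0 : ℝ) < n := by exact_mod_cast hn
  rw [← Real.exp_add, ← Real.exp_add]
  rcases lt_trichotomy a b with h | rfl | h
  · have : (a : ℝ) / n < b / n := by gcongr
    rw [sign_neg (sub_neg.2 h), sign_neg (sub_neg.2 (Real.exp_lt_exp.2 (by linarith)))]
  · simp [add_comm]
  · have : (b : ℝ) / n < a / n := by gcongr
    rw [sign_pos (sub_pos.2 h), sign_pos (sub_pos.2 (Real.exp_lt_exp.2 (by linarith)))]

theorem sign_det_homog {n m : ℕ} (hn : 0 < n) {u v : Vertex} (hu : Valid m u) (hv : Valid m v) :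
    SignType.sign (det (homog n m u) (homog n m v)) = SignType.sign (order u v) := by
  rcases u with k | k | (_ | _) <;> rcases v with l | l | (_ | _) <;>
    simp only [det, homog, order, mul_zero, mul_one, zero_sub, sub_zero, zero_mul, one_mul,
      sub_self, Left.sign_neg, sign_one, sign_zero, neg_mul, mul_neg, sub_neg_eq_add]
  case outer.outer => exact sign_det_exp k l hn
  case inner.inner =>
    rw [← sign_det_exp l k hv]
    congr 1
    ring
  case inner.outer =>
    refine sign_neg ?_
    rw [← neg_add', Left.neg_neg_iff]
    positivity
  all_goals rw [sign_pos (by positivity)]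

theorem order_eq_zero {u v : Vertex} : order u v = 0 ↔ u = v := by
  rcases u with k | k | (_ | _) <;> rcases v with l | l | (_ | _) <;>
    simp [order, sub_eq_zero, eq_comm]

theorem det_homog_eq_zero {n m : ℕ} (hn : 0 < n) {u v : Vertex} (hu : Valid m u)
    (hv : Valid m v) : det (homog n m u) (homog n m v) = 0 ↔ u = v := by
  rw [← order_eq_zero, ← sign_eq_zero_iff, sign_det_homog hn hu hv, sign_eq_zero_iff]

theorem crosses_iff_det {n m : ℕ} (hn : 0 < n) {u v r s : Vertex} (hu : Valid m u)
    (hv : Valid m v) (hr : Valid m r) (hs : Valid m s) :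
    Crosses u v r s ↔ det (homog n m u) (homog n m r) * det (homog n m v) (homog n m r) *
      det (homog n m u) (homog n m s) * det (homog n m v) (homog n m s) < 0 := by
  rw [Crosses, ← sign_eq_neg_one_iff, ← sign_eq_neg_one_iff]
  simp only [sign_mul, sign_det_homog hn hu hr, sign_det_homog hn hv hr, sign_det_homog hn hu hs,
    sign_det_homog hn hv hs]

/-- The part of the open disc that lies over `S`. -/
def interiorOver (S : Set Annulus) : Set ℂ :=
  disc '' {p | p.2 ∈ Set.Ioo (0 : I) 1 ∧ cover p ∈ S}

/-- `S` contains the image of the interior of a curve in the closed disc from `u` to `v`. -/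
def Connects (n m : ℕ) (S : Set Annulus) (u v : Vertex) : Prop :=
  ∃ f : C(I, ℂ), f 0 = ideal (homog n m u) ∧ f 1 = ideal (homog n m v) ∧
    ∀ t ∈ Set.Ioo (0 : I) 1, f t ∈ interiorOver S

theorem Connects.symm {n m : ℕ} {S : Set Annulus} {u v : Vertex} (h : Connects n m S u v) :
    Connects n m S v u := by
  obtain ⟨f, h0, h1, h⟩ := h
  exact ⟨⟨fun t => f (unitInterval.symm t), by fun_prop⟩, by simpa using h1, by simpa using h0,
    fun t ht => h _ ⟨by simpa using unitInterval.strictAnti_symm ht.2,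
      by simpa using unitInterval.strictAnti_symm ht.1⟩⟩

theorem Connects.exists_curve {n m : ℕ} {S : Set Annulus} {u v : Vertex}
    (h : Connects n m S u v) : ∃ f : C(I, ℂ), f 0 = ideal (homog n m u) ∧
      f 1 = ideal (homog n m v) ∧ ∀ t, (f t = ideal (homog n m u) ∨ f t = ideal (homog n m v)) ∨
        f t ∈ interiorOver S := by
  obtain ⟨f, f0, f1, hf⟩ := h
  refine ⟨f, f0, f1, fun t => ?_⟩
  rcases (unitInterval.nonneg' (t := t)).eq_or_lt with rfl | h0
  · exact Or.inl (Or.inl f0)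
  rcases (unitInterval.le_one' (t := t)).eq_or_lt with rfl | h1
  · exact Or.inl (Or.inr f1)
  · exact Or.inr (hf t ⟨h0, h1⟩)

theorem norm_lt_of_mem_interiorOver {S : Set Annulus} {x : ℂ} (hx : x ∈ interiorOver S) :
    ‖x‖ < 1 := by
  obtain ⟨p, ⟨hp, -⟩, rfl⟩ := hx
  exact norm_disc_lt_one_iff.2 hp

theorem not_disjoint_of_mem_interiorOver {S S' : Set Annulus} {x : ℂ} (h : x ∈ interiorOver S)
    (h' : x ∈ interiorOver S') : ¬ Disjoint S S' := by
  obtain ⟨p, ⟨-, hp⟩, rfl⟩ := h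
  obtain ⟨q, ⟨-, hq⟩, hqp⟩ := h'
  exact Set.not_disjoint_iff.2 ⟨_, hp, disc_injective hqp ▸ hq⟩

theorem not_disjoint_of_crosses {n m : ℕ} (hn : 0 < n) {S S' : Set Annulus} {u v r s : Vertex}
    (hu : Valid m u) (hv : Valid m v) (hr : Valid m r) (hs : Valid m s) (hc : Crosses u v r s)
    (h : Connects n m S u v) (h' : Connects n m S' r s) : ¬ Disjoint S S' := by
  rw [crosses_iff_det hn hu hv hr hs] at hc
  obtain ⟨f, f0, f1, hf⟩ := h.exists_curve
  obtain ⟨g, g0, g1, hg⟩ := h'.exists_curve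
  have hz := homog_ne_zero n m
  set z := homog n m
  have norm_one (a) : ‖ideal (z a)‖ = 1 := norm_ideal (hz a)
  have hpos (a) : 0 < normSq (z a) := normSq_pos.2 (hz a)
  have norm_le {S : Set Annulus} {a b : Vertex} {x : ℂ} :
      (x = ideal (z a) ∨ x = ideal (z b)) ∨ x ∈ interiorOver S → ‖x‖ ≤ 1 := by
    rintro ((rfl | rfl) | hx)
    exacts [(norm_one a).le, (norm_one b).le, (norm_lt_of_mem_interiorOver hx).le]
  have ideal_ne {a b} (hdet : det (z a) (z b) ≠ 0) : ideal (z a) ≠ ideal (z b) :=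
    hdet ∘ det_eq_zero_of_ideal_eq (hz a) (hz b)
  obtain ⟨⟨⟨hur, hvr⟩, hus⟩, hvs⟩ : ((det (z u) (z r) ≠ 0 ∧ det (z v) (z r) ≠ 0) ∧
    det (z u) (z s) ≠ 0) ∧ det (z v) (z s) ≠ 0 := by simpa only [mul_ne_zero_iff] using hc.ne
  obtain ⟨x, y, hxy⟩ := exists_meet (c := 16 * (det (z u) (z r) * det (z v) (z r) *
      det (z u) (z s) * det (z v) (z s)) / (normSq (z u) * normSq (z v) * normSq (z r) *
        normSq (z s))) (fun t => norm_le (hf t)) (fun t => norm_le (hg t)) (f0 ▸ norm_one u)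
    (f1 ▸ norm_one v) (g0 ▸ norm_one r) (g1 ▸ norm_one s)
    (div_neg_of_neg_of_pos (by linarith)
      (mul_pos (mul_pos (mul_pos (hpos u) (hpos v)) (hpos r)) (hpos s)))
    (by rw [f0, f1, g0, g1, prod_one_sub_ideal_div (hz u) (hz v) (hz r) (hz s)])
  have hgy := hg y
  rw [← hxy] at hgy
  rcases hf x with hx | hx <;> rcases hgy with hy | hy
  · rcases hx with hx | hx <;> rcases hy with hy | hy
    exacts [(ideal_ne hur (hx ▸ hy)).elim, (ideal_ne hus (hx ▸ hy)).elim,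
      (ideal_ne hvr (hx ▸ hy)).elim, (ideal_ne hvs (hx ▸ hy)).elim]
  · have hlt := norm_lt_of_mem_interiorOver hy
    rcases hx with hx | hx <;> exact (hlt.ne (hx ▸ norm_one _)).elim
  · have hlt := norm_lt_of_mem_interiorOver hx
    rcases hy with hy | hy <;> exact (hlt.ne (hy ▸ norm_one _)).elim
  · exact not_disjoint_of_mem_interiorOver hx hy

end AnnulusTriangulation

namespace AnnulusTriangulation

open Filter Topology unitInterval

/-! ### Deck transformations -/

/-- The deck transformations of the strip. -/
noncomputable def shiftStrip (τ : ℤ) (p : Strip) : Strip := (p.1 + τ, p.2)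

theorem continuous_shiftStrip (τ : ℤ) : Continuous (shiftStrip τ) := by
  unfold shiftStrip
  fun_prop

theorem cover_eq_iff {p q : Strip} : cover p = cover q ↔ ∃ τ : ℤ, q = shiftStrip τ p := by
  change ((p.1 : UnitAddCircle), p.2) = ((q.1 : UnitAddCircle), q.2) ↔ _
  simp only [Prod.mk.injEq, shiftStrip]
  rw [QuotientAddGroup.eq, AddSubgroup.mem_zmultiples_iff]
  constructor
  · rintro ⟨⟨k, hk⟩, h2⟩
    exact ⟨k, Prod.ext (by simpa [eq_neg_add_iff_add_eq, eq_comm] using hk) h2.symm⟩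
  · rintro ⟨τ, rfl⟩
    exact ⟨⟨τ, by simp⟩, rfl⟩

theorem cover_shiftStrip (τ : ℤ) (p : Strip) : cover (shiftStrip τ p) = cover p :=
  (cover_eq_iff.2 ⟨τ, rfl⟩).symm

/-- The action of the deck transformations on vertices. -/
def shift (n m : ℕ) (τ : ℤ) : Vertex → Vertex
  | .outer k => .outer (k + τ * n)
  | .inner k => .inner (k + τ * m)
  | .limit d => .limit d

theorem shift_shift (n m : ℕ) (τ τ' : ℤ) (u : Vertex) :
    shift n m τ' (shift n m τ u) = shift n m (τ + τ') u := by
  cases u <;> simp [shift] <;> ring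

variable {n m : ℕ}

theorem Valid.shift (τ : ℤ) {u : Vertex} (hu : Valid m u) : Valid m (shift n m τ u) := by
  cases u <;> exact hu

theorem isMarked_shift {τ : ℤ} {u : Vertex} : (shift n m τ u).IsMarked m ↔ u.IsMarked m := by
  cases u <;> exact Iff.rfl

theorem shift_eq_self (hn : 0 < n) {τ : ℤ} {u : Vertex} (hu : u.IsMarked m)
    (h : shift n m τ u = u) : τ = 0 := by
  rcases u with k | k | _
  · simpa [shift, hn.ne'] using h
  · simpa [shift, (show 0 < m from hu).ne'] using h
  · exact hu.elim

theorem position_shift (hn : 0 < n) (τ : ℤ) {u : Vertex} (hu : u.IsMarked m) :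
    position n m (shift n m τ u) = shiftStrip τ (position n m u) := by
  rcases u with k | k | _
  · simp [position, shift, outerPoint, shiftStrip, add_div, hn.ne']
  · simp [position, shift, innerPoint, shiftStrip, add_div, (show 0 < m from hu).ne']
  · exact hu.elim

theorem position_injOn (hn : 0 < n) : Set.InjOn (position n m) {u | u.IsMarked m} := by
  rintro (k | k | _) hu (l | l | _) hv h
  case outer.outer => simpa [position, outerPoint, hn.ne'] using h
  case inner.inner => simpa [position, innerPoint, (show 0 < m from hu).ne'] using h
  all_goals first
    | exact hu.elim
    | exact hv.elim
    | simp [position, outerPoint, innerPoint] at h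

theorem exists_position_of_isMarked {p : Annulus} (h : IsMarked n m p) :
    ∃ u : Vertex, u.IsMarked m ∧ p = cover (position n m u) := by
  rcases h with ⟨_, k, rfl⟩ | ⟨hm, k, rfl⟩
  · exact ⟨.outer k, trivial, rfl⟩
  · exact ⟨.inner k, hm, rfl⟩

theorem isMarked_position (hn : 0 < n) {u : Vertex} (hu : u.IsMarked m) :
    IsMarked n m (cover (position n m u)) := by
  rcases u with k | k | _
  · exact Or.inl ⟨hn, k, rfl⟩
  · exact Or.inr ⟨hu, k, rfl⟩
  · exact hu.elim

theorem exists_shift_eq_of_cover_position_eq (hn : 0 < n) {u : Vertex} {p : Strip}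
    (hu : u.IsMarked m) (h : cover p = cover (position n m u)) :
    ∃ τ, (shift n m τ u).IsMarked m ∧ p = position n m (shift n m τ u) := by
  obtain ⟨τ, hτ⟩ := cover_eq_iff.1 h.symm
  exact ⟨τ, isMarked_shift.2 hu, by rw [position_shift hn τ hu, hτ]⟩

theorem eq_shift_of_position_eq (hn : 0 < n) {τ : ℤ} {u v : Vertex} (hu : u.IsMarked m)
    (hv : v.IsMarked m) (h : position n m v = shiftStrip τ (position n m u)) :
    v = shift n m τ u :=
  position_injOn hn hv (isMarked_shift.2 hu) (by rw [h, position_shift hn τ hu])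

/-! ### Lifting curves and homotopies to the strip -/

section

variable {X : Type*} [TopologicalSpace X]

/-- A curve in the strip moved by a deck transformation. -/
noncomputable def shiftLift (τ : ℤ) (c : C(X, Strip)) : C(X, Strip) :=
  ⟨fun t => shiftStrip τ (c t), (continuous_shiftStrip τ).comp c.continuous⟩

theorem cover_shiftLift (τ : ℤ) (c : C(X, Strip)) : cover.comp (shiftLift τ c) = cover.comp c :=
  ContinuousMap.ext fun t => cover_shiftStrip τ (c t)

theorem exists_lift_through {c : C(X, Strip)} {x : X} {p : Strip} (h : cover (c x) = cover p) :
    ∃ c' : C(X, Strip), cover.comp c' = cover.comp c ∧ c' x = p := by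
  obtain ⟨τ, rfl⟩ := cover_eq_iff.1 h
  exact ⟨shiftLift τ c, cover_shiftLift τ c, rfl⟩

theorem exists_eq_shiftLift [PreconnectedSpace X] [Nonempty X] {c c' : C(X, Strip)}
    (h : cover.comp c = cover.comp c') : ∃ τ, c' = shiftLift τ c := by
  have x := Classical.arbitrary X
  obtain ⟨τ, hτ⟩ := cover_eq_iff.1 (DFunLike.congr_fun h x)
  have hfst : (fun t => (c' t).1) = fun t => (shiftLift τ c t).1 :=
    (AddCircle.isCoveringMap_coe (1 : ℝ)).eq_of_comp_eq (by fun_prop) (by fun_prop)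
      (funext fun t => congrArg Prod.fst
        (DFunLike.congr_fun ((cover_shiftLift τ c).trans h) t).symm) x (congrArg Prod.fst hτ)
  exact ⟨τ, ContinuousMap.ext fun t => Prod.ext (congrFun hfst t)
    (congrArg Prod.snd (DFunLike.congr_fun h t)).symm⟩

/-- The point that divides the segment from `p` to `q` in the ratio `s : 1 - s`. -/
noncomputable def mix (s : I) (p q : Strip) : Strip :=
  ((1 - (s : ℝ)) * p.1 + s * q.1,
    ⟨(1 - (s : ℝ)) * p.2 + s * q.2, convex_Icc (0 : ℝ) 1 p.2.2 q.2.2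
      (sub_nonneg.2 s.2.2) s.2.1 (sub_add_cancel _ _)⟩)

theorem mix_self (s : I) (p : Strip) : mix s p p = p :=
  Prod.ext (by simp [mix]; ring) (Subtype.ext (by simp [mix]; ring))

/-- The straight-line homotopy between two curves in the strip. -/
noncomputable def straightLine (c c' : C(X, Strip)) : c.Homotopy c' where
  toFun z := mix z.1 (c z.2) (c' z.2)
  continuous_toFun := by unfold mix; fun_prop
  map_zero_left _ := by simp [mix]
  map_one_left _ := by simp [mix]

theorem straightLine_eq {c c' : C(X, Strip)} {t : X} (h : c t = c' t) (s : I) :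
    straightLine c c' (s, t) = c t :=
  (congrArg (mix s (c t)) h.symm).trans (mix_self s (c t))

end

theorem homotopicRel_of_ends_eq {c c' : C(I, Strip)} (h0 : c 0 = c' 0) (h1 : c 1 = c' 1) :
    (cover.comp c).HomotopicRel (cover.comp c') {0, 1} :=
  ContinuousMap.HomotopicRel.comp_continuousMap ⟨⟨straightLine c c', fun s t ht => by
    rcases ht with rfl | rfl
    exacts [straightLine_eq h0 s, straightLine_eq h1 s]⟩⟩ cover

theorem exists_lift (γ : C(I, Annulus)) {p : Strip} (hp : γ 0 = cover p) :
    ∃ c : C(I, Strip), cover.comp c = γ ∧ c 0 = p := by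
  obtain ⟨l, hl, h0⟩ := (AddCircle.isCoveringMap_coe (1 : ℝ)).exists_path_lifts
    ⟨fun t => (γ t).1, by fun_prop⟩ p.1 (congrArg Prod.fst hp)
  refine ⟨⟨fun t => (l t, (γ t).2), by fun_prop⟩, ?_, ?_⟩
  · exact ContinuousMap.ext fun t => Prod.ext (congrFun hl t) rfl
  · exact Prod.ext h0 (congrArg Prod.snd hp :)

theorem end_eq_of_homotopicRel {c c' : C(I, Strip)} (h0 : c 0 = c' 0)
    (h : (cover.comp c).HomotopicRel (cover.comp c') {0, 1}) : c 1 = c' 1 := by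
  let fstStrip : C(Strip, ℝ) := ⟨Prod.fst, continuous_fst⟩
  let fstAnnulus : C(Annulus, UnitAddCircle) := ⟨Prod.fst, continuous_fst⟩
  have hfst : (fstStrip.comp c).HomotopicRel (fstStrip.comp c') {0, 1} := by
    rw [(AddCircle.isCoveringMap_coe (1 : ℝ)).homotopicRel_iff_comp
      ⟨0, by simp, congrArg Prod.fst h0⟩]
    exact h.comp_continuousMap fstAnnulus
  obtain ⟨H⟩ := h
  obtain ⟨H'⟩ := hfst
  exact Prod.ext (H'.fst_eq_snd (x := 1) (by simp))
    (congrArg Prod.snd (H.fst_eq_snd (x := 1) (by simp)) :)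

/-- A curve in the strip, run through backwards. -/
def reverseLift (c : C(I, Strip)) : C(I, Strip) := ⟨fun t => c (σ t), by fun_prop⟩

theorem reverse_cover (c : C(I, Strip)) : reverse (cover.comp c) = cover.comp (reverseLift c) := rfl

theorem reverseLift_zero (c : C(I, Strip)) : reverseLift c 0 = c 1 := by simp [reverseLift]

theorem reverseLift_one (c : C(I, Strip)) : reverseLift c 1 = c 0 := by simp [reverseLift]

theorem exists_lift_of_homotopicRel {c : C(I, Strip)} {γ : C(I, Annulus)}
    (h : (cover.comp c).HomotopicRel γ {0, 1}) :
    ∃ c' : C(I, Strip), cover.comp c' = γ ∧ c' 0 = c 0 ∧ c' 1 = c 1 := by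
  obtain ⟨H⟩ := id h
  obtain ⟨c', rfl, h0⟩ := exists_lift γ (H.fst_eq_snd (x := 0) (by simp)).symm
  exact ⟨c', rfl, h0, (end_eq_of_homotopicRel h0.symm h).symm⟩

theorem exists_lift_of_sameClass {c : C(I, Strip)} {γ : C(I, Annulus)}
    (h : SameClass (cover.comp c) γ) : ∃ c' : C(I, Strip), cover.comp c' = γ ∧
      ((c' 0 = c 0 ∧ c' 1 = c 1) ∨ (c' 0 = c 1 ∧ c' 1 = c 0)) := by
  rcases h with h | h
  · obtain ⟨c', rfl, hends⟩ := exists_lift_of_homotopicRel h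
    exact ⟨c', rfl, Or.inl hends⟩
  · rw [reverse_cover] at h
    obtain ⟨c', rfl, hends⟩ := exists_lift_of_homotopicRel h
    rw [reverseLift_zero, reverseLift_one] at hends
    exact ⟨c', rfl, Or.inr hends⟩

theorem ends_eq_of_sameClass {c c' : C(I, Strip)} (h : SameClass (cover.comp c) (cover.comp c')) :
    ∃ τ : ℤ, (c' 0 = shiftStrip τ (c 0) ∧ c' 1 = shiftStrip τ (c 1)) ∨
      (c' 0 = shiftStrip τ (c 1) ∧ c' 1 = shiftStrip τ (c 0)) := by
  obtain ⟨c'', hcover, hends⟩ := exists_lift_of_sameClass h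
  obtain ⟨τ, rfl⟩ := exists_eq_shiftLift hcover
  refine ⟨τ, hends.imp ?_ ?_⟩ <;>
  · rintro ⟨h0, h1⟩
    exact ⟨congrArg (shiftStrip τ) h0, congrArg (shiftStrip τ) h1⟩

theorem IsArcCurve.reverse {γ : C(I, Annulus)} (h : IsArcCurve n m γ) :
    IsArcCurve n m (reverse γ) := by
  have hσ : ∀ t ∈ Set.Ioo (0 : I) 1, σ t ∈ Set.Ioo (0 : I) 1 := fun t ht =>
    ⟨by simpa using strictAnti_symm ht.2, by simpa using strictAnti_symm ht.1⟩
  have sameClass_of_reverse {δ} (hδ : SameClass (AnnulusTriangulation.reverse γ) δ) :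
      SameClass γ δ :=
    sameClass_equivalence.trans (Or.inr (.refl _)) hδ
  refine ⟨by simpa [AnnulusTriangulation.reverse] using h.marked_one,
    by simpa [AnnulusTriangulation.reverse] using h.marked_zero,
    fun t ht => h.interior _ (hσ t ht),
    fun s hs t ht hst => symm_bijective.injective (h.simple (hσ s hs) (hσ t ht) hst),
    fun hcon => h.not_contractible ?_,
    fun k hk hseg => h.not_outerSegment k hk (sameClass_of_reverse hseg),
    fun k hk hseg => h.not_innerSegment k hk (sameClass_of_reverse hseg)⟩
  obtain ⟨H⟩ := id hcon
  have hends : γ 0 = AnnulusTriangulation.reverse γ 0 := by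
    simpa [AnnulusTriangulation.reverse] using H.fst_eq_snd (x := 1) (by simp)
  have hrev := reverse_homotopicRel hcon
  rwa [reverse_reverse, ← hends] at hrev

theorem StripSpirals.mix {d : Direction} {ρ ρ' : C(NNReal, Strip)} (h : StripSpirals d ρ)
    (h' : StripSpirals d ρ') (s : I) : StripSpirals d ((straightLine ρ ρ').curry s) := by
  have s0 := s.2.1
  have s1 := s.2.2
  constructor
  · cases d with
    | right =>
      refine tendsto_atTop.2 fun B => ?_
      filter_upwards [h.1.eventually (eventually_ge_atTop B),
        h'.1.eventually (eventually_ge_atTop B)] with t h1 h2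
      exact convex_Ici B h1 h2 (sub_nonneg.2 s1) s0 (sub_add_cancel _ _)
    | left =>
      refine tendsto_atBot.2 fun B => ?_
      filter_upwards [h.1.eventually (eventually_le_atBot B),
        h'.1.eventually (eventually_le_atBot B)] with t h1 h2
      exact convex_Iic B h1 h2 (sub_nonneg.2 s1) s0 (sub_add_cancel _ _)
  · have hlim := ((tendsto_subtype_rng.1 h.2).const_mul (1 - (s : ℝ))).add
      ((tendsto_subtype_rng.1 h'.2).const_mul (s : ℝ))
    rw [← add_mul, sub_add_cancel, one_mul] at hlim
    exact tendsto_subtype_rng.2 hlim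

theorem IsAsymptoticCurve.stripSpirals {d : Direction} {ρ : C(NNReal, Strip)}
    (h : IsAsymptoticCurve n m d (cover.comp ρ)) : StripSpirals d ρ := by
  obtain ⟨ρ', hcover, h1, h2⟩ := h.spirals
  obtain ⟨τ, rfl⟩ := exists_eq_shiftLift hcover
  refine ⟨?_, h2⟩
  cases d with
  | right => exact tendsto_atTop_add_const_right _ _ h1
  | left => exact tendsto_atBot_add_const_right _ _ h1

theorem homotopicWith_of_start_eq {d : Direction} {ρ ρ' : C(NNReal, Strip)}
    (hρ : StripSpirals d ρ) (hρ' : StripSpirals d ρ') (h : ρ 0 = ρ' 0) :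
    (cover.comp ρ).HomotopicWith (cover.comp ρ')
      (fun γ => γ 0 = cover.comp ρ 0 ∧ Spirals d γ) :=
  ⟨⟨.comp (.refl cover) (straightLine ρ ρ'), fun s =>
    ⟨congrArg cover (straightLine_eq h s), _, rfl, hρ.mix hρ' s⟩⟩⟩

theorem start_eq_of_homotopicWith {d : Direction} {γ δ : C(NNReal, Annulus)}
    (h : γ.HomotopicWith δ (fun h => h 0 = γ 0 ∧ Spirals d h)) : δ 0 = γ 0 := by
  obtain ⟨H⟩ := h
  simpa only [ContinuousMap.Homotopy.curry_one] using (H.prop 1).1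

/-! ### Lifts of arcs -/

/-- The arc has a lift from `u` to `v`. -/
def HasLift : Arc n m → Vertex → Vertex → Prop
  | .finite α, u, v => u.IsMarked m ∧ v.IsMarked m ∧
      ∃ (c : C(I, Strip)) (h : IsArcCurve n m (cover.comp c)),
        c 0 = position n m u ∧ c 1 = position n m v ∧
          Quotient.mk (finiteArcSetoid n m) ⟨cover.comp c, h⟩ = α
  | .asymptotic d α, u, v => u.IsMarked m ∧ v = .limit d ∧
      ∃ (ρ : C(NNReal, Strip)) (h : IsAsymptoticCurve n m d (cover.comp ρ)),
        ρ 0 = position n m u ∧ Quotient.mk (asymptoticArcSetoid n m d) ⟨cover.comp ρ, h⟩ = α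

theorem HasLift.isMarked {α : Arc n m} {u v : Vertex} (h : HasLift α u v) : u.IsMarked m := by
  cases α <;> exact h.1

theorem HasLift.valid_left {α : Arc n m} {u v : Vertex} (h : HasLift α u v) : Valid m u :=
  h.isMarked.valid

theorem HasLift.valid_right {α : Arc n m} {u v : Vertex} (h : HasLift α u v) : Valid m v := by
  cases α with
  | finite α => exact h.2.1.valid
  | asymptotic d α => exact h.2.1 ▸ trivial

theorem exists_hasLift (hn : 0 < n) (α : Arc n m) : ∃ u v, HasLift α u v := by
  rcases α with α | ⟨d, α⟩
  · obtain ⟨⟨γ, h⟩, rfl⟩ := Quotient.exists_rep α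
    obtain ⟨u, hu, h0⟩ := exists_position_of_isMarked h.marked_zero
    obtain ⟨w, hw, h1⟩ := exists_position_of_isMarked h.marked_one
    obtain ⟨c, rfl, hc⟩ := exists_lift γ h0
    obtain ⟨τ, hτw, hτ⟩ := exists_shift_eq_of_cover_position_eq hn hw h1
    exact ⟨u, shift n m τ w, hu, hτw, c, h, hc, hτ, rfl⟩
  · obtain ⟨⟨γ, h⟩, rfl⟩ := Quotient.exists_rep α
    obtain ⟨u, hu, h0⟩ := exists_position_of_isMarked h.marked_zero
    obtain ⟨ρ, rfl, -⟩ := id h.spirals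
    obtain ⟨τ, hτu, hτ⟩ := exists_shift_eq_of_cover_position_eq hn hu h0
    exact ⟨shift n m τ u, _, hτu, rfl, ρ, h, hτ, rfl⟩

theorem HasLift.symm {α : FiniteArc n m} {u v : Vertex} (h : HasLift (.finite α) u v) :
    HasLift (.finite α) v u := by
  obtain ⟨hu, hv, c, hc, h0, h1, rfl⟩ := h
  refine ⟨hv, hu, reverseLift c, hc.reverse, by rw [reverseLift_zero, h1],
    by rw [reverseLift_one, h0], Quotient.sound (s := finiteArcSetoid n m) ?_⟩
  exact sameClass_equivalence.symm (Or.inr (.refl (cover.comp (reverseLift c))))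

theorem HasLift.eq_shift (hn : 0 < n) {α : Arc n m} {u v u' v' : Vertex} (h : HasLift α u v)
    (h' : HasLift α u' v') : ∃ τ : ℤ, (u' = shift n m τ u ∧ v' = shift n m τ v) ∨
      (u' = shift n m τ v ∧ v' = shift n m τ u) := by
  cases α with
  | finite α =>
    obtain ⟨hu, hv, c, hc, h0, h1, rfl⟩ := h
    obtain ⟨hu', hv', c', hc', h0', h1', heq⟩ := h'
    have hsame : SameClass (cover.comp c) (cover.comp c') := Quotient.exact heq.symm
    obtain ⟨τ, hτ⟩ := ends_eq_of_sameClass hsame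
    rw [h0, h1, h0', h1'] at hτ
    exact ⟨τ, hτ.imp
      (.imp (eq_shift_of_position_eq hn hu hu') (eq_shift_of_position_eq hn hv hv'))
      (.imp (eq_shift_of_position_eq hn hv hu') (eq_shift_of_position_eq hn hu hv'))⟩
  | asymptotic d α =>
    obtain ⟨hu, rfl, ρ, hρ, h0, rfl⟩ := h
    obtain ⟨hu', rfl, ρ', hρ', h0', heq⟩ := h'
    have hstart : cover (ρ 0) = cover (ρ' 0) := start_eq_of_homotopicWith (Quotient.exact heq)
    rw [h0, h0'] at hstart
    obtain ⟨τ, hτ⟩ := cover_eq_iff.1 hstart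
    exact ⟨τ, Or.inl ⟨eq_shift_of_position_eq hn hu hu' hτ, rfl⟩⟩

theorem HasLift.shift (hn : 0 < n) {α : Arc n m} {u v : Vertex} (h : HasLift α u v) (τ : ℤ) :
    HasLift α (shift n m τ u) (shift n m τ v) := by
  cases α with
  | finite α =>
    obtain ⟨hu, hv, c, hc, h0, h1, rfl⟩ := h
    have hcover := cover_shiftLift τ c
    refine ⟨isMarked_shift.2 hu, isMarked_shift.2 hv, shiftLift τ c, by rwa [hcover], ?_, ?_, ?_⟩
    · rw [position_shift hn τ hu, ← h0]; rfl
    · rw [position_shift hn τ hv, ← h1]; rfl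
    · simp only [hcover]
  | asymptotic d α =>
    obtain ⟨hu, rfl, ρ, hρ, h0, rfl⟩ := h
    have hcover := cover_shiftLift τ ρ
    refine ⟨isMarked_shift.2 hu, rfl, shiftLift τ ρ, by rwa [hcover], ?_, ?_⟩
    · rw [position_shift hn τ hu, ← h0]; rfl
    · simp only [hcover]

theorem HasLift.unique {α β : Arc n m} {u v : Vertex} (h : HasLift α u v) (h' : HasLift β u v) :
    α = β := by
  cases α <;> cases β
  case finite.finite =>
    obtain ⟨-, -, c, hc, h0, h1, rfl⟩ := h
    obtain ⟨-, -, c', hc', h0', h1', rfl⟩ := h'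
    exact congrArg Arc.finite (Quotient.sound (s := finiteArcSetoid n m)
      (Or.inl (homotopicRel_of_ends_eq (h0.trans h0'.symm) (h1.trans h1'.symm))))
  case asymptotic.asymptotic =>
    obtain ⟨-, rfl, ρ, hρ, h0, rfl⟩ := h
    obtain ⟨-, hd, ρ', hρ', h0', rfl⟩ := h'
    cases hd
    exact congrArg (Arc.asymptotic _) (Quotient.sound (s := asymptoticArcSetoid n m _)
      (homotopicWith_of_start_eq hρ.stripSpirals hρ'.stripSpirals (h0.trans h0'.symm)))
  case finite.asymptotic => exact (h'.2.1 ▸ h.2.1 : Vertex.IsMarked m (.limit _)).elim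
  case asymptotic.finite => exact (h.2.1 ▸ h'.2.1 : Vertex.IsMarked m (.limit _)).elim

end AnnulusTriangulation

namespace AnnulusTriangulation

open Filter Topology unitInterval

variable {n m : ℕ}

/-! ### Traces of arcs connect the endpoints of lifts -/

theorem connects_of_lift {u v : Vertex} (hu : u.IsMarked m) (hv : v.IsMarked m)
    {c : C(I, Strip)} (hc : IsArcCurve n m (cover.comp c)) (h0 : c 0 = position n m u)
    (h1 : c 1 = position n m v) : Connects n m (cover.comp c '' Set.Ioo 0 1) u v :=
  ⟨⟨fun t => disc (c t), continuous_disc.comp c.continuous⟩,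
    (congrArg disc h0).trans (disc_position n m hu),
    (congrArg disc h1).trans (disc_position n m hv),
    fun t ht => ⟨c t, ⟨hc.interior t ht, Set.mem_image_of_mem _ ht⟩, rfl⟩⟩

theorem tendsto_one_of_re {ι : Type*} {l : Filter ι} {z : ι → ℂ} (hz : ∀ t, ‖z t‖ ≤ 1)
    (h : Tendsto (fun t => (z t).re) l (𝓝 1)) : Tendsto z l (𝓝 1) := by
  rw [tendsto_iff_norm_sub_tendsto_zero]
  have hsqrt : Tendsto (fun t => √(2 * (1 - (z t).re))) l (𝓝 0) := by
    simpa using ((h.const_sub 1).const_mul 2).sqrt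
  refine squeeze_zero (fun _ => norm_nonneg _) (fun t => Real.le_sqrt_of_sq_le ?_) hsqrt
  have hle : Complex.normSq (z t) ≤ 1 := by
    rw [Complex.normSq_eq_norm_sq]
    exact pow_le_one₀ (norm_nonneg _) (hz t)
  rw [← Complex.normSq_eq_norm_sq]
  rw [Complex.normSq_apply] at hle ⊢
  simp only [Complex.sub_re, Complex.sub_im, Complex.one_re, Complex.one_im]
  linarith

theorem tendsto_tanh_atTop : Tendsto Real.tanh atTop (𝓝 1) := by
  have hexp : Tendsto (fun x => 1 - Real.exp (-x)) atTop (𝓝 1) := by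
    simpa using Real.tendsto_exp_neg_atTop_nhds_zero.const_sub 1
  refine tendsto_of_tendsto_of_tendsto_of_le_of_le hexp tendsto_const_nhds (fun x => ?_)
    fun x => (Real.tanh_lt_one x).le
  have hcosh : 1 - Real.tanh x = Real.exp (-x) / Real.cosh x := by
    rw [← Real.cosh_sub_sinh, sub_div, div_self (Real.cosh_pos x).ne', Real.tanh_eq_sinh_div_cosh]
  have := div_le_self (Real.exp_pos (-x)).le (Real.one_le_cosh x)
  dsimp only
  linarith

theorem tendsto_disc {d : Direction} {ρ : C(NNReal, Strip)} (h : StripSpirals d ρ) :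
    Tendsto (fun t => disc (ρ t)) atTop (𝓝 (ideal (homog n m (.limit d)))) := by
  cases d with
  | right =>
    have hideal : ideal (homog n m (.limit .right)) = 1 := by
      have h_one : homog n m (.limit .right) = 1 := rfl
      simp [ideal, h_one]
    rw [hideal]
    exact tendsto_one_of_re (fun t => norm_disc_le _) (tendsto_tanh_atTop.comp h.1)
  | left =>
    have hideal : ideal (homog n m (.limit .left)) = -1 := by
      simp [ideal, homog, div_eq_iff, Complex.ext_iff]
    have hneg := (tendsto_one_of_re (l := atTop) (z := fun t => -disc (ρ t))
      (fun t => (norm_neg _).trans_le (norm_disc_le _)) ?_).neg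
    · simpa only [hideal, neg_neg] using hneg
    · simpa only [Function.comp_def, Real.tanh_neg, disc, Complex.neg_re] using
        tendsto_tanh_atTop.comp (tendsto_neg_atBot_atTop.comp h.1)

/-- A parametrization of the half line by the unit interval, with the junk value `0` at `1`. -/
noncomputable def halfLine (t : I) : NNReal := Real.toNNReal (t / (1 - t))

theorem halfLine_zero : halfLine 0 = 0 := by simp [halfLine]

theorem halfLine_pos {t : I} (ht : t ∈ Set.Ioo (0 : I) 1) : 0 < halfLine t :=
  Real.toNNReal_pos.2 (div_pos ht.1 (sub_pos.2 ht.2))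

theorem continuousAt_halfLine {t : I} (ht : t ≠ 1) : ContinuousAt halfLine t := by
  have h : (1 : ℝ) - t ≠ 0 := fun h => ht (Subtype.ext (sub_eq_zero.1 h).symm)
  unfold halfLine
  fun_prop (disch := exact h)

theorem tendsto_halfLine : Tendsto halfLine (𝓝[≠] 1) atTop := by
  have hval : Tendsto (fun t : I => (t : ℝ)) (𝓝[≠] 1) (𝓝 1) :=
    (continuous_subtype_val.tendsto' (1 : I) 1 rfl).mono_left nhdsWithin_le_nhds
  have hpos : Tendsto (fun t : I => 1 - (t : ℝ)) (𝓝[≠] 1) (𝓝[>] 0) := by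
    refine tendsto_nhdsWithin_iff.2 ⟨by simpa using hval.const_sub 1, ?_⟩
    filter_upwards [self_mem_nhdsWithin] with t ht
    exact sub_pos.2 (lt_of_le_of_ne t.2.2 fun h => ht (Subtype.ext h))
  exact Real.tendsto_toNNReal_atTop.comp
    (hval.pos_mul_atTop one_pos (tendsto_inv_nhdsGT_zero.comp hpos))

theorem connects_of_spiral {u : Vertex} {d : Direction} (hu : u.IsMarked m)
    {ρ : C(NNReal, Strip)} (hρ : IsAsymptoticCurve n m d (cover.comp ρ))
    (h0 : ρ 0 = position n m u) :
    Connects n m (cover.comp ρ '' Set.Ioi 0) u (.limit d) := by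
  let f : I → ℂ := Function.update (fun t => disc (ρ (halfLine t))) 1
    (ideal (homog n m (.limit d)))
  have hf_of_ne {t : I} (ht : t ≠ 1) : f t = disc (ρ (halfLine t)) := Function.update_of_ne ht _ _
  have hf : Continuous f := by
    rw [continuous_iff_continuousAt]
    intro t
    rcases eq_or_ne t 1 with rfl | ht
    · exact continuousAt_update_same.2 ((tendsto_disc hρ.stripSpirals).comp tendsto_halfLine)
    · exact (continuousAt_update_of_ne ht).2
        ((continuous_disc.comp ρ.continuous).continuousAt.comp (continuousAt_halfLine ht))
  have hf_one : f 1 = ideal (homog n m (.limit d)) := Function.update_self _ _ _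
  refine ⟨⟨f, hf⟩, ?_, hf_one, fun t ht => ⟨ρ (halfLine t),
    ⟨?_, Set.mem_image_of_mem _ (halfLine_pos ht)⟩, (hf_of_ne ht.2.ne).symm⟩⟩
  · exact (hf_of_ne zero_ne_one).trans (by rw [halfLine_zero, h0, disc_position n m hu])
  · rcases hρ.interior _ (halfLine_pos ht) with ⟨-, h⟩ | ⟨-, h⟩
    · exact ⟨h.1, h.2.trans_le le_one'⟩
    · exact ⟨nonneg'.trans_lt h.1, h.2⟩

theorem HasLift.connects {α : Arc n m} {u v : Vertex} (h : HasLift α u v)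
    {S : Set Annulus} (hS : IsTrace α S) : Connects n m S u v := by
  cases α with
  | finite α =>
    obtain ⟨⟨γ, hγ⟩, hα, rfl⟩ := hS
    obtain ⟨hu, hv, c, hc, h0, h1, rfl⟩ := h
    have hsame : SameClass (cover.comp c) γ := sameClass_equivalence.symm (Quotient.exact hα)
    obtain ⟨c', rfl, ⟨h0', h1'⟩ | ⟨h0', h1'⟩⟩ := exists_lift_of_sameClass hsame
    · exact connects_of_lift hu hv hγ (h0'.trans h0) (h1'.trans h1)
    · exact (connects_of_lift hv hu hγ (h0'.trans h1) (h1'.trans h0)).symm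
  | asymptotic d α =>
    obtain ⟨⟨γ, hγ⟩, hα, rfl⟩ := hS
    obtain ⟨hu, rfl, ρ, hρ, h0, rfl⟩ := h
    obtain ⟨ρ', rfl, -⟩ := id hγ.spirals
    have hstart : cover (ρ' 0) = cover (ρ 0) := (start_eq_of_homotopicWith (Quotient.exact hα)).symm
    obtain ⟨ρ'', hcover, h0''⟩ := exists_lift_through hstart
    simp only [← hcover] at hγ ⊢
    exact connects_of_spiral hu hγ (h0''.trans h0)

theorem not_crosses_of_compatible (hn : 0 < n) {α β : Arc n m} {u v r s : Vertex}
    (hα : HasLift α u v) (hβ : HasLift β r s) (h : Compatible α β) : ¬ Crosses u v r s := by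
  obtain ⟨S, S', hS, hS', hdisjoint⟩ := h
  exact fun hc => not_disjoint_of_crosses hn hα.valid_left hα.valid_right hβ.valid_left
    hβ.valid_right hc (hα.connects hS) (hβ.connects hS') hdisjoint

/-! ### Essential pairs of vertices -/

/-- A boundary segment joins the two vertices. -/
def IsSegment (u v : Vertex) : Prop :=
  ∃ k, (u = .outer k ∧ v = .outer (k + 1)) ∨ (u = .inner k ∧ v = .inner (k + 1))

/-- Two vertices that are neither equal nor joined by a boundary segment. -/
def Essential (u v : Vertex) : Prop := u ≠ v ∧ ¬ IsSegment u v ∧ ¬ IsSegment v u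

theorem exists_outerSegment_lift (n m : ℕ) (k : ℤ) :
    ∃ c : C(I, Strip), cover.comp c = outerSegment n k ∧ c 0 = position n m (.outer k) ∧
      c 1 = position n m (.outer (k + 1)) :=
  ⟨⟨fun t => (((k : ℝ) + (t : ℝ)) / n, 0), by fun_prop⟩, rfl, by simp [position, outerPoint],
    by simp [position, outerPoint]⟩

theorem exists_innerSegment_lift (n m : ℕ) (k : ℤ) :
    ∃ c : C(I, Strip), cover.comp c = innerSegment m k ∧ c 0 = position n m (.inner k) ∧
      c 1 = position n m (.inner (k + 1)) :=
  ⟨⟨fun t => (((k : ℝ) + (t : ℝ)) / m, 1), by fun_prop⟩, rfl, by simp [position, innerPoint],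
    by simp [position, innerPoint]⟩

theorem HasLift.not_isSegment (hn : 0 < n) {α : FiniteArc n m} {u v : Vertex}
    (h : HasLift (.finite α) u v) : ¬ IsSegment u v := by
  obtain ⟨hu, -, c, hc, h0, h1, rfl⟩ := h
  rintro ⟨k, ⟨rfl, rfl⟩ | ⟨rfl, rfl⟩⟩
  · obtain ⟨c', hc', h0', h1'⟩ := exists_outerSegment_lift n m k
    exact hc.not_outerSegment k hn
      (hc' ▸ Or.inl (homotopicRel_of_ends_eq (h0.trans h0'.symm) (h1.trans h1'.symm)))
  · obtain ⟨c', hc', h0', h1'⟩ := exists_innerSegment_lift n m k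
    exact hc.not_innerSegment k hu
      (hc' ▸ Or.inl (homotopicRel_of_ends_eq (h0.trans h0'.symm) (h1.trans h1'.symm)))

theorem HasLift.essential (hn : 0 < n) {α : Arc n m} {u v : Vertex} (h : HasLift α u v) :
    Essential u v := by
  cases α with
  | finite α =>
    refine ⟨?_, h.not_isSegment hn, h.symm.not_isSegment hn⟩
    rintro rfl
    obtain ⟨-, -, c, hc, h0, h1, rfl⟩ := h
    exact hc.not_contractible
      (homotopicRel_of_ends_eq (c' := .const I (c 0)) rfl (h1.trans h0.symm))
  | asymptotic d α =>
    obtain ⟨hu, rfl, -⟩ := h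
    refine ⟨fun huv => (huv ▸ hu : Vertex.IsMarked m (.limit d)), ?_, ?_⟩ <;>
      rintro ⟨k, ⟨hk, hk'⟩ | ⟨hk, hk'⟩⟩ <;> simp at hk hk'

end AnnulusTriangulation

namespace AnnulusTriangulation

open Filter Topology unitInterval

/-! ### Geodesics -/

/-- The polar form of the quadratic form with matrix `!![1 - x, y; y, 1 + x]` at `z = x + y * I`.
It is positive definite for `z` in the open disc, and there `a` and `b` are orthogonal if and only
if `z` lies on the line through `ideal a` and `ideal b`. -/
def polar (z a b : ℂ) : ℝ :=
  (1 - z.re) * (a.re * b.re) + (1 + z.re) * (a.im * b.im) + z.im * (a.re * b.im + a.im * b.re)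

theorem polar_comm (z a b : ℂ) : polar z a b = polar z b a := by simp only [polar]; ring

theorem polar_det_mul_det (z a b c d : ℂ) :
    det a b * det c d * (1 - Complex.normSq z) =
      polar z a c * polar z b d - polar z a d * polar z b c := by
  simp only [det, polar, Complex.normSq_apply]
  ring

theorem polar_self_pos {z a : ℂ} (hz : ‖z‖ < 1) (ha : a ≠ 0) : 0 < polar z a a := by
  have hz' : Complex.normSq z < 1 := by
    rw [Complex.normSq_eq_norm_sq]
    exact pow_lt_one₀ (norm_nonneg z) hz two_ne_zero
  have hre : 0 < 1 + z.re := by linarith [(abs_lt.1 ((Complex.abs_re_le_norm z).trans_lt hz)).1]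
  have hsq : (1 + z.re) * polar z a a =
      ((1 + z.re) * a.im + z.im * a.re) ^ 2 + (1 - Complex.normSq z) * a.re ^ 2 := by
    simp only [polar, Complex.normSq_apply]
    ring
  refine pos_of_mul_pos_right (hsq ▸ ?_) hre.le
  rcases eq_or_ne a.re 0 with h | h
  · have him : a.im ≠ 0 := fun h' => ha (Complex.ext h h')
    rw [h, mul_zero, add_zero]
    positivity
  · have := sub_pos.2 hz'
    positivity

theorem det_eq_zero_of_orthogonal {z a b c : ℂ} (hz : ‖z‖ < 1) (hc : c ≠ 0)
    (hac : polar z c a = 0) (hbc : polar z c b = 0) : det a b = 0 := by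
  have hz' : 0 < 1 - Complex.normSq z := by
    rw [Complex.normSq_eq_norm_sq]
    exact sub_pos.2 (pow_lt_one₀ (norm_nonneg z) hz two_ne_zero)
  have hdet : det c (Complex.I * c) = Complex.normSq c := by simp [det, Complex.normSq_apply]
  have h := polar_det_mul_det z c (Complex.I * c) a b
  rw [hac, hbc, hdet, zero_mul, zero_mul, sub_zero] at h
  simpa [hz'.ne', hc] using h

theorem polar_gram (z u v r s : ℂ) :
    polar z u u * (polar z v v * polar z r s - polar z v s * polar z v r) -
      polar z u v * (polar z u v * polar z r s - polar z v s * polar z u r) +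
        polar z u s * (polar z u v * polar z v r - polar z v v * polar z u r) = 0 := by
  simp only [polar]
  ring

theorem det_eq_zero_of_orthogonal_pairs {z u v r s : ℂ} (hz : ‖z‖ < 1) (hu : u ≠ 0) (hv : v ≠ 0)
    (hr : r ≠ 0) (hs : s ≠ 0) (huv : polar z u v = 0) (hrs : polar z r s = 0)
    (h : 0 ≤ det u r * det v r * det u s * det v s) :
    (det r u = 0 ∧ det s v = 0) ∨ (det r v = 0 ∧ det s u = 0) := by
  have huu := polar_self_pos hz hu
  have hvv := polar_self_pos hz hv
  have hsr : polar z s r = 0 := (polar_comm z s r).trans hrs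
  have hgram := polar_gram z u v r s
  have hprod : 0 ≤ polar z u r * polar z u s * (polar z v r * polar z v s) := by
    have hu' := polar_det_mul_det z u r u s
    have hv' := polar_det_mul_det z v r v s
    rw [polar_comm z r u, hrs] at hu'
    rw [polar_comm z r v, hrs] at hv'
    linarith [mul_nonneg h (sq_nonneg (1 - Complex.normSq z)),
      congrArg₂ (· * ·) hu' hv']
  have hu0 : polar z u r * polar z u s = 0 := by
    have hsq : (polar z u r * polar z u s) ^ 2 * polar z v v =
        -(polar z u u * (polar z u r * polar z u s * (polar z v r * polar z v s))) := by
      rw [huv, hrs] at hgram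
      linear_combination -(polar z u r * polar z u s) * hgram
    exact pow_eq_zero_iff two_ne_zero |>.1 <| (sq_nonneg _).antisymm' <|
      nonpos_of_mul_nonpos_left (hsq.trans_le (neg_nonpos.2 (mul_nonneg huu.le hprod))) hvv
  rcases mul_eq_zero.1 hu0 with hur | hus
  · exact Or.inr ⟨det_eq_zero_of_orthogonal hz hu hur huv,
      det_eq_zero_of_orthogonal hz hr hrs ((polar_comm z r u).trans hur)⟩
  · exact Or.inl ⟨det_eq_zero_of_orthogonal hz hs hsr ((polar_comm z s u).trans hus),
      det_eq_zero_of_orthogonal hz hu hus huv⟩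

theorem polar_ideal_self {a : ℂ} (ha : a ≠ 0) (b : ℂ) : polar (ideal a) a b = 0 := by
  have ha' : a.re ^ 2 + a.im ^ 2 ≠ 0 := by
    simpa [Complex.normSq_apply, sq] using Complex.normSq_pos.2 ha |>.ne'
  simp only [polar, ideal, Complex.div_re, Complex.div_im, Complex.conj_re, Complex.conj_im,
    Complex.normSq_apply, ← sq]
  field_simp
  ring

theorem polar_lineMap (z w a b : ℂ) (t : ℝ) :
    polar (AffineMap.lineMap z w t) a b = (1 - t) * polar z a b + t * polar w a b := by
  simp only [polar, AffineMap.lineMap_apply_module, Complex.add_re, Complex.add_im, Complex.smul_re,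
    Complex.smul_im, smul_eq_mul]
  ring

theorem polar_disc (p : Strip) (a b : ℂ) :
    polar (disc p) a b = (Real.exp (-p.1) * (a.re * b.re) + Real.exp p.1 * (a.im * b.im) +
      (2 * p.2 - 1) * (a.re * b.im + a.im * b.re)) / Real.cosh p.1 := by
  have := (Real.cosh_pos p.1).ne'
  rw [← Real.cosh_sub_sinh, ← Real.cosh_add_sinh]
  simp only [polar, disc, Real.tanh_eq_sinh_div_cosh]
  field_simp

/-- The geodesic between two vertices in the Klein model of the hyperbolic plane, without its
endpoints. -/
def geodesic (n m : ℕ) (u v : Vertex) : Set Strip :=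
  {p | p.2 ∈ Set.Ioo (0 : I) 1 ∧ polar (disc p) (homog n m u) (homog n m v) = 0}

variable {n m : ℕ}

theorem geodesic_disjoint (hn : 0 < n) {u v r s : Vertex} (hu : Valid m u) (hv : Valid m v)
    (hr : Valid m r) (hs : Valid m s) (hc : ¬ Crosses u v r s) (hne : ¬ (r = u ∧ s = v))
    (hne' : ¬ (r = v ∧ s = u)) : Disjoint (geodesic n m u v) (geodesic n m r s) := by
  rw [Set.disjoint_left]
  rintro p ⟨hp, huv⟩ ⟨-, hrs⟩
  rw [crosses_iff_det hn hu hv hr hs, not_lt] at hc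
  have hz := homog_ne_zero n m
  rcases det_eq_zero_of_orthogonal_pairs (norm_disc_lt_one_iff.2 hp) (hz u) (hz v) (hz r) (hz s)
    huv hrs hc with ⟨h, h'⟩ | ⟨h, h'⟩
  · exact hne ⟨(det_homog_eq_zero hn hr hu).1 h, (det_homog_eq_zero hn hs hv).1 h'⟩
  · exact hne' ⟨(det_homog_eq_zero hn hr hv).1 h, (det_homog_eq_zero hn hs hu).1 h'⟩

theorem homog_shift (hn : 0 < n) (τ : ℤ) {u : Vertex} (hu : Valid m u) :
    ∃ c : ℝ, (homog n m (shift n m τ u)).re = c * (Real.exp (τ / 2) * (homog n m u).re) ∧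
      (homog n m (shift n m τ u)).im = c * (Real.exp (-(τ / 2)) * (homog n m u).im) := by
  have hexp {k : ℕ} (hk : 0 < k) (j : ℤ) :
      ((j + τ * k : ℤ) : ℝ) / k / 2 = τ / 2 + (j : ℝ) / k / 2 := by
    push_cast
    field_simp
    ring
  rcases u with k | k | (_ | _)
  · exact ⟨1, by simp only [shift, homog, hexp hn, Real.exp_add, one_mul],
      by simp only [shift, homog, hexp hn, neg_add, Real.exp_add, one_mul]⟩
  · exact ⟨1, by simp only [shift, homog, hexp hu, Real.exp_add, one_mul, mul_neg],
      by simp only [shift, homog, hexp hu, neg_add, Real.exp_add, one_mul]⟩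
  · exact ⟨Real.exp (-(τ / 2)), by simp [shift, homog, ← Real.exp_add], by simp [shift, homog]⟩
  · exact ⟨Real.exp (τ / 2), by simp [shift, homog], by simp [shift, homog, ← Real.exp_add]⟩

theorem shiftStrip_mem_geodesic (hn : 0 < n) (τ : ℤ) {u v : Vertex} (hu : Valid m u)
    (hv : Valid m v) {p : Strip} (hp : p ∈ geodesic n m u v) :
    shiftStrip τ p ∈ geodesic n m (shift n m τ u) (shift n m τ v) := by
  refine ⟨hp.1, ?_⟩
  obtain ⟨c, hre, him⟩ := homog_shift hn τ hu
  obtain ⟨d, hre', him'⟩ := homog_shift hn τ hv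
  have h := hp.2
  rw [polar_disc, div_eq_zero_iff, or_iff_left (Real.cosh_pos _).ne'] at h ⊢
  have hτ : Real.exp τ = Real.exp (τ / 2) ^ 2 := by rw [← Real.exp_nat_mul]; push_cast; ring_nf
  have hinv : Real.exp (-(τ / 2)) = (Real.exp (τ / 2))⁻¹ := Real.exp_neg _
  simp only [shiftStrip, neg_add, Real.exp_add, hre, him, hre', him', hinv, Real.exp_neg (τ : ℝ),
    hτ]
  field_simp
  linear_combination c * d * h

/-! ### Arcs represented by geodesics -/

/-- The inverse of `disc`; the height is clamped to the strip, which matters only outside the closed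
disc. -/
noncomputable def ofDisc (z : ℂ) : Strip :=
  (Real.artanh z.re, Set.projIcc 0 1 zero_le_one ((1 + z.im / √(1 - z.re ^ 2)) / 2))

theorem disc_ofDisc {z : ℂ} (hz : ‖z‖ ≤ 1) (hre : z.re ∈ Set.Ioo (-1) 1) : disc (ofDisc z) = z := by
  have hpos : 0 < 1 - z.re ^ 2 := by nlinarith [hre.1, hre.2]
  have hnorm : z.re * z.re + z.im * z.im ≤ 1 := by
    rw [← Complex.normSq_apply, Complex.normSq_eq_norm_sq]
    exact pow_le_one₀ (norm_nonneg z) hz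
  have him : |z.im / √(1 - z.re ^ 2)| ≤ 1 := by
    rw [abs_div, abs_of_pos (Real.sqrt_pos.2 hpos), div_le_one (Real.sqrt_pos.2 hpos)]
    exact Real.abs_le_sqrt (by linarith)
  obtain ⟨hlo, hhi⟩ := abs_le.1 him
  have hsqrt := (Real.sqrt_pos.2 hpos).ne'
  refine Complex.ext (Real.tanh_artanh hre) ?_
  simp only [disc, ofDisc, Real.cosh_artanh hre]
  rw [Set.projIcc_of_mem zero_le_one ⟨by linarith, by linarith⟩]
  field_simp
  ring

theorem disc_re_mem_Ioo (p : Strip) : (disc p).re ∈ Set.Ioo (-1) 1 :=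
  ⟨Real.neg_one_lt_tanh p.1, Real.tanh_lt_one p.1⟩

theorem ofDisc_disc (p : Strip) : ofDisc (disc p) = p :=
  disc_injective (disc_ofDisc (norm_disc_le p) (disc_re_mem_Ioo p))

theorem continuousOn_ofDisc : ContinuousOn ofDisc {z | z.re ∈ Set.Ioo (-1) 1} := by
  intro z ⟨hlo, hhi⟩
  have hpos : 0 < 1 - z.re ^ 2 := by nlinarith
  have hsub : 1 - z.re ≠ 0 := by linarith
  have hlog : √((1 + z.re) / (1 - z.re)) ≠ 0 :=
    (Real.sqrt_pos.2 (div_pos (by linarith) (by linarith))).ne'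
  have hre : ContinuousAt (fun z : ℂ => Real.artanh z.re) z := by
    unfold Real.artanh
    exact ContinuousAt.log (by fun_prop (disch := exact hsub)) hlog
  have him : ContinuousAt (fun z : ℂ => (1 + z.im / √(1 - z.re ^ 2)) / 2) z := by
    fun_prop (disch := exact (Real.sqrt_pos.2 hpos).ne')
  exact (hre.prodMk (continuous_projIcc.continuousAt.comp him)).continuousWithinAt

/-- No translate of the chord crosses it. -/
def SelfNoncrossing (n m : ℕ) (u v : Vertex) : Prop :=
  ∀ τ : ℤ, ¬ Crosses u v (shift n m τ u) (shift n m τ v)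

theorem eq_of_cover_eq_of_geodesic (hn : 0 < n) {u v : Vertex} (hu : u.IsMarked m) (hv : Valid m v)
    (hc : SelfNoncrossing n m u v) {p q : Strip} (hp : p ∈ geodesic n m u v)
    (hq : q ∈ geodesic n m u v) (h : cover p = cover q) : p = q := by
  obtain ⟨τ, rfl⟩ := cover_eq_iff.1 h
  rcases eq_or_ne τ 0 with rfl | hτ
  · simp [shiftStrip]
  refine (Set.disjoint_left.1 (geodesic_disjoint hn hu.valid hv (hu.valid.shift τ) (hv.shift τ)
    (hc τ) (fun h => hτ (shift_eq_self hn hu h.1)) fun h => ?_) hq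
    (shiftStrip_mem_geodesic hn τ hu.valid hv hp)).elim
  have htwice := shift_shift n m τ τ u
  rw [h.1, h.2] at htwice
  have := shift_eq_self hn hu htwice.symm
  lia

theorem exists_geodesic_curve (hn : 0 < n) {u v : Vertex} (hu : u.IsMarked m) (hv : v.IsMarked m)
    (huv : u ≠ v) : ∃ c : C(I, Strip), c 0 = position n m u ∧ c 1 = position n m v ∧
      Function.Injective c ∧ ∀ t ∈ Set.Ioo (0 : I) 1, c t ∈ geodesic n m u v := by
  set a := disc (position n m u) with ha
  set b := disc (position n m v) with hb
  have hab : a ≠ b := fun h => huv (position_injOn hn hu hv (disc_injective h))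
  let line (t : I) : ℂ := AffineMap.lineMap a b (t : ℝ)
  have hnorm (t) : line t ∈ Metric.closedBall 0 1 :=
    (convex_closedBall 0 1).lineMap_mem (by simpa using norm_disc_le _)
      (by simpa using norm_disc_le _) t.2
  have hre (t) : (line t).re ∈ Set.Ioo (-1) 1 :=
    ((convex_Ioo (-1 : ℝ) 1).linear_preimage Complex.reLm).lineMap_mem
      (disc_re_mem_Ioo _) (disc_re_mem_Ioo _) t.2
  have hdisc (t) : disc (ofDisc (line t)) = line t :=
    disc_ofDisc (mem_closedBall_zero_iff.1 (hnorm t)) (hre t)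
  refine ⟨⟨fun t => ofDisc (line t), continuousOn_ofDisc.comp_continuous
    (AffineMap.lineMap_continuous.comp continuous_subtype_val) hre⟩,
    by simp [line, a, ofDisc_disc], by simp [line, b, ofDisc_disc], fun s t h => ?_,
    fun t ht => ⟨?_, ?_⟩⟩
  · have hline : line s = line t := by rw [← hdisc s, ← hdisc t]; exact congrArg disc h
    exact Subtype.ext (AffineMap.lineMap_injective ℝ hab hline)
  · rw [← norm_disc_lt_one_iff, ContinuousMap.coe_mk, hdisc]
    have hlt : ‖(1 - (t : ℝ)) • a + (t : ℝ) • b‖ < 1 := norm_combo_lt_of_ne (norm_disc_le _)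
      (norm_disc_le _) hab (sub_pos.2 ht.2) ht.1 (sub_add_cancel _ _)
    simpa only [line, AffineMap.lineMap_apply_module] using hlt
  · rw [ContinuousMap.coe_mk, hdisc, polar_lineMap, ha, hb, disc_position n m hu,
      disc_position n m hv, polar_ideal_self (homog_ne_zero n m u), polar_comm,
      polar_ideal_self (homog_ne_zero n m v), mul_zero, mul_zero, add_zero]

theorem IsSegment.shift {u v : Vertex} (h : IsSegment u v) (τ : ℤ) :
    IsSegment (shift n m τ u) (shift n m τ v) := by
  obtain ⟨k, ⟨rfl, rfl⟩ | ⟨rfl, rfl⟩⟩ := h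
  · exact ⟨k + τ * n, Or.inl ⟨rfl, congrArg Vertex.outer (by ring)⟩⟩
  · exact ⟨k + τ * m, Or.inr ⟨rfl, congrArg Vertex.inner (by ring)⟩⟩

theorem Essential.not_sameClass (hn : 0 < n) {u v a b : Vertex} (he : Essential u v)
    (hu : u.IsMarked m) (hv : v.IsMarked m) (ha : a.IsMarked m) (hb : b.IsMarked m)
    (hab : IsSegment a b) {c e : C(I, Strip)} (hc0 : c 0 = position n m u)
    (hc1 : c 1 = position n m v) (he0 : e 0 = position n m a) (he1 : e 1 = position n m b) :
    ¬ SameClass (cover.comp c) (cover.comp e) := by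
  intro h
  obtain ⟨τ, h⟩ := ends_eq_of_sameClass (sameClass_equivalence.symm h)
  rw [hc0, hc1, he0, he1] at h
  rcases h with ⟨h0, h1⟩ | ⟨h0, h1⟩
  · apply he.2.1
    rw [eq_shift_of_position_eq hn ha hu h0, eq_shift_of_position_eq hn hb hv h1]
    exact hab.shift τ
  · apply he.2.2
    rw [eq_shift_of_position_eq hn hb hu h0, eq_shift_of_position_eq hn ha hv h1]
    exact hab.shift τ

theorem isArcCurve_of_geodesic (hn : 0 < n) {u v : Vertex} (hu : u.IsMarked m)
    (hv : v.IsMarked m) (he : Essential u v) (hc : SelfNoncrossing n m u v) {c : C(I, Strip)}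
    (h0 : c 0 = position n m u) (h1 : c 1 = position n m v) (hinj : Function.Injective c)
    (hgeo : ∀ t ∈ Set.Ioo (0 : I) 1, c t ∈ geodesic n m u v) :
    IsArcCurve n m (cover.comp c) where
  marked_zero := (congrArg cover h0).symm ▸ isMarked_position hn hu
  marked_one := (congrArg cover h1).symm ▸ isMarked_position hn hv
  interior t ht := (hgeo t ht).1
  simple _ hs _ ht h :=
    hinj (eq_of_cover_eq_of_geodesic hn hu hv.valid hc (hgeo _ hs) (hgeo _ ht) h)
  not_contractible h := he.1 <| position_injOn hn hu hv <| by
    rw [← h0, ← h1]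
    exact (end_eq_of_homotopicRel (c := c) (c' := .const I (c 0)) rfl h).symm
  not_outerSegment k _ := by
    obtain ⟨e, hcover, he0, he1⟩ := exists_outerSegment_lift n m k
    exact hcover ▸ he.not_sameClass (a := .outer k) (b := .outer (k + 1)) hn hu hv
      trivial trivial ⟨k, Or.inl ⟨rfl, rfl⟩⟩ h0 h1 he0 he1
  not_innerSegment k hm := by
    obtain ⟨e, hcover, he0, he1⟩ := exists_innerSegment_lift n m k
    exact hcover ▸ he.not_sameClass (a := .inner k) (b := .inner (k + 1)) hn hu hv
      hm hm ⟨k, Or.inr ⟨rfl, rfl⟩⟩ h0 h1 he0 he1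

theorem exists_geodesic_finite (hn : 0 < n) {u v : Vertex} (hu : u.IsMarked m)
    (hv : v.IsMarked m) (he : Essential u v) (hc : SelfNoncrossing n m u v) :
    ∃ α : Arc n m, HasLift α u v ∧ ∃ S, IsTrace α S ∧ S ⊆ cover '' geodesic n m u v := by
  obtain ⟨c, h0, h1, hinj, hgeo⟩ := exists_geodesic_curve hn hu hv he.1
  have hcurve := isArcCurve_of_geodesic hn hu hv he hc h0 h1 hinj hgeo
  refine ⟨.finite (Quotient.mk _ ⟨_, hcurve⟩), ⟨hu, hv, c, hcurve, h0, h1, rfl⟩, _,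
    ⟨⟨_, hcurve⟩, rfl, rfl⟩, ?_⟩
  rintro _ ⟨t, ht, rfl⟩
  exact ⟨c t, hgeo t ht, rfl⟩

/-- The geodesic from the `k`-th outer marked point to the right limit point, as a graph over the
horizontal axis. -/
noncomputable def spiral (n : ℕ) (k : ℤ) : C(NNReal, Strip) where
  toFun t := ((k : ℝ) / n + t, ⟨(1 - Real.exp (-t)) / 2, by
    have := Real.exp_le_one_iff.2 (neg_nonpos.2 t.coe_nonneg)
    constructor <;> linarith [Real.exp_pos (-t)]⟩)
  continuous_toFun := by fun_prop

theorem spiral_zero (n m : ℕ) (k : ℤ) : spiral n k 0 = position n m (.outer k) :=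
  Prod.ext (by simp [spiral, position, outerPoint])
    (Subtype.ext (by simp [spiral, position, outerPoint]))

theorem spiral_mem_Ioo (n : ℕ) (k : ℤ) {t : NNReal} (ht : 0 < t) :
    (spiral n k t).2 ∈ Set.Ioo 0 meridian := by
  have hlt : Real.exp (-t) < 1 := Real.exp_lt_one_iff.2 (neg_lt_zero.2 (NNReal.coe_pos.2 ht))
  constructor
  · exact (show (0 : ℝ) < (1 - Real.exp (-t)) / 2 by linarith)
  · exact (show (1 - Real.exp (-t)) / 2 < (1 / 2 : ℝ) by linarith [Real.exp_pos (-t)])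

theorem spiral_mem_geodesic (n m : ℕ) (k : ℤ) {t : NNReal} (ht : 0 < t) :
    spiral n k t ∈ geodesic n m (.outer k) (.limit .right) := by
  refine ⟨⟨(spiral_mem_Ioo n k ht).1, (spiral_mem_Ioo n k ht).2.trans ?_⟩, ?_⟩
  · exact (show (1 / 2 : ℝ) < 1 by norm_num)
  · rw [polar_disc, div_eq_zero_iff]
    left
    have hexp : Real.exp (-((k : ℝ) / n + t)) * Real.exp ((k : ℝ) / n / 2) =
        Real.exp (-t) * Real.exp (-((k : ℝ) / n / 2)) := by
      rw [← Real.exp_add, ← Real.exp_add]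
      ring_nf
    simp only [spiral, homog, ContinuousMap.coe_mk]
    linear_combination hexp

theorem stripSpirals_spiral (n : ℕ) (k : ℤ) : StripSpirals .right (spiral n k) := by
  refine ⟨tendsto_atTop_add_const_left _ _ (NNReal.tendsto_coe_atTop.2 tendsto_id), ?_⟩
  have hexp : Tendsto (fun t : NNReal => Real.exp (-t)) atTop (𝓝 0) :=
    Real.tendsto_exp_neg_atTop_nhds_zero.comp (NNReal.tendsto_coe_atTop.2 tendsto_id)
  exact tendsto_subtype_rng.2 (by simpa [spiral, meridian] using (hexp.const_sub 1).div_const 2)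

theorem isAsymptoticCurve_spiral (hn : 0 < n) (k : ℤ)
    (hc : SelfNoncrossing n m (.outer k) (.limit .right)) :
    IsAsymptoticCurve n m .right (cover.comp (spiral n k)) where
  marked_zero := (congrArg cover (spiral_zero n m k)).symm ▸ isMarked_position hn trivial
  interior t ht := Or.inl
    ⟨congrArg (fun p => (cover p).2) (spiral_zero n m k), spiral_mem_Ioo n k ht⟩
  simple s t h := by
    have eq_zero {t : NNReal} (h : cover (spiral n k 0) = cover (spiral n k t)) : t = 0 := by
      by_contra ht
      have hpos := (spiral_mem_Ioo n k (pos_iff_ne_zero.2 ht)).1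
      have hheight : (spiral n k 0).2 = (spiral n k t).2 :=
        congrArg (Prod.snd : Annulus → I) h
      rw [← hheight, spiral_zero n m k] at hpos
      exact lt_irrefl _ hpos
    rcases eq_or_ne s 0 with rfl | hs
    · exact (eq_zero h).symm
    rcases eq_or_ne t 0 with rfl | ht
    · exact eq_zero h.symm
    have heq := eq_of_cover_eq_of_geodesic (u := .outer k) (v := .limit .right) hn trivial trivial
      hc (spiral_mem_geodesic n m k (pos_iff_ne_zero.2 hs))
      (spiral_mem_geodesic n m k (pos_iff_ne_zero.2 ht)) h
    exact NNReal.coe_injective (add_left_cancel (congrArg Prod.fst heq :))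
  spirals := ⟨_, rfl, stripSpirals_spiral n k⟩

theorem exists_geodesic_spiral (hn : 0 < n) (k : ℤ)
    (hc : SelfNoncrossing n m (.outer k) (.limit .right)) :
    ∃ α : Arc n m, HasLift α (.outer k) (.limit .right) ∧
      ∃ S, IsTrace α S ∧ S ⊆ cover '' geodesic n m (.outer k) (.limit .right) := by
  have hcurve := isAsymptoticCurve_spiral hn k hc
  refine ⟨.asymptotic .right (Quotient.mk _ ⟨_, hcurve⟩),
    ⟨trivial, rfl, _, hcurve, spiral_zero n m k, rfl⟩, _, ⟨⟨_, hcurve⟩, rfl, rfl⟩, ?_⟩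
  rintro _ ⟨t, ht, rfl⟩
  exact ⟨spiral n k t, spiral_mem_geodesic n m k ht, rfl⟩

theorem compatible_of_not_crosses (hn : 0 < n) {α β : Arc n m} {u v r s : Vertex}
    (hα : HasLift α u v) (hβ : HasLift β r s) (hαβ : α ≠ β)
    (hc : ∀ τ, ¬ Crosses r s (shift n m τ u) (shift n m τ v)) {S S' : Set Annulus}
    (hS : IsTrace α S) (hS' : IsTrace β S') (hg : S ⊆ cover '' geodesic n m u v)
    (hg' : S' ⊆ cover '' geodesic n m r s) : Compatible α β := by
  refine ⟨S, S', hS, hS', Set.disjoint_left.2 fun x hx hx' => ?_⟩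
  obtain ⟨p, hp, rfl⟩ := hg hx
  obtain ⟨q, hq, hpq⟩ := hg' hx'
  obtain ⟨τ, rfl⟩ := cover_eq_iff.1 hpq.symm
  have hlift := hα.shift hn τ
  refine Set.disjoint_left.1 (geodesic_disjoint hn hβ.valid_left hβ.valid_right hlift.valid_left
    hlift.valid_right (hc τ) ?_ ?_) hq
    (shiftStrip_mem_geodesic hn τ hα.valid_left hα.valid_right hp)
  · rintro ⟨hr, hs⟩
    exact hαβ ((hr ▸ hs ▸ hlift).unique hβ)
  · rintro ⟨hs, hr⟩
    cases α with
    | finite α => exact hαβ ((hs ▸ hr ▸ hlift).symm.unique hβ)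
    | asymptotic d α => exact absurd hβ.isMarked (by simp [← hr, hlift.2.1, Vertex.IsMarked])

end AnnulusTriangulation

/-! ### The triangulation of a periodic pattern -/

namespace AnnulusTriangulation

theorem order_antisymm (u v : Vertex) : order v u = -order u v := by
  rcases u with i | i | (_ | _) <;> rcases v with j | j | (_ | _) <;> simp [order]

theorem crosses_comm {u v r s : Vertex} : Crosses u v r s ↔ Crosses r s u v := by
  rw [Crosses, Crosses, order_antisymm u r, order_antisymm u s, order_antisymm v r,
    order_antisymm v s]
  ring_nf

theorem crosses_swap {u v r s : Vertex} : Crosses u v r s ↔ Crosses v u r s := by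
  rw [Crosses, Crosses, mul_comm (order u r), mul_right_comm _ (order u s)]

theorem IsSegment.not_crosses {u v : Vertex} (h : IsSegment u v) (r s : Vertex) :
    ¬ Crosses u v r s := by
  have hsame (w : Vertex) : 0 ≤ order u w * order v w := by
    obtain ⟨k, ⟨rfl, rfl⟩ | ⟨rfl, rfl⟩⟩ := h <;> rcases w with l | l | (_ | _) <;>
      simp only [order, mul_nonneg_iff] <;> lia
  rw [Crosses, not_lt, mul_assoc _ (order u s)]
  exact mul_nonneg (hsame r) (hsame s)

end AnnulusTriangulation

namespace PeriodicPattern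

open AnnulusTriangulation PtolemyPattern

variable (P : PeriodicPattern)

/-- The edges of the triangulation of the strip that belongs to a pattern, each with one of its
orientations. The skeletal vertex `k` is joined to the interval `[height k, height (k + 1)]` of the
opposite boundary, or to a limit point if there are no marked points on that boundary. -/
def Link : Vertex → Vertex → Prop
  | .outer i, .outer j => P.UnitChord i j
  | .outer k, .inner l => 0 < P.total ∧ P.Skeletal k ∧ P.height k ≤ l ∧ l ≤ P.height (k + 1)
  | .outer k, .limit .right => P.total = 0 ∧ P.Skeletal k
  | .inner k, .inner l => 0 < P.total ∧ l = k + 1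
  | _, _ => False

/-- Adjacency in the triangulation of the strip. -/
def Adj (u v : Vertex) : Prop := P.Link u v ∨ P.Link v u

variable {P} {u v r s : Vertex} {i j k l : ℤ}

theorem Link.isMarked_left (h : P.Link u v) : u.IsMarked P.total := by
  rcases u with i | i | i
  · trivial
  · rcases v with j | j | j
    exacts [h.elim, h.1, h.elim]
  · exact h.elim

theorem Link.essential_or_isSegment (h : P.Link u v) : Essential u v ∨ IsSegment u v := by
  refine or_iff_not_imp_right.2 fun hseg => ⟨?_, hseg, ?_⟩
  · rintro rfl
    rcases u with i | i | i
    exacts [h.1.false, by simpa using h.2, h]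
  · rintro ⟨k, ⟨rfl, rfl⟩ | ⟨rfl, rfl⟩⟩
    exacts [absurd h.1 (by lia), absurd h.2 (by lia)]

theorem Link.shift (h : P.Link u v) (τ : ℤ) :
    P.Link (shift P.n P.total τ u) (shift P.n P.total τ v) := by
  rcases u with i | i | i <;> rcases v with j | j | (_ | _)
  case outer.outer => exact (P.unitChord_shift τ).2 h
  case outer.inner =>
    obtain ⟨hm, hsk, hlo, hhi⟩ := h
    refine ⟨hm, (P.skeletal_shift _ _).2 hsk, ?_, ?_⟩
    · rw [P.height_shift]
      lia
    · rw [add_right_comm, P.height_shift]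
      lia
  case outer.limit.right => exact ⟨h.1, (P.skeletal_shift _ _).2 h.2⟩
  case inner.inner => exact ⟨h.1, by rw [h.2]; ring⟩
  all_goals exact h.elim

theorem not_crosses_of_unitChord (h : P.UnitChord i j) (hrs : P.Link r s) :
    ¬ Crosses (.outer i) (.outer j) r s := by
  intro hc
  have hij := h.1
  rcases r with k | k | k <;> rcases s with l | l | (_ | _)
  case outer.outer =>
    have hkl := hrs.1
    have hleft := h.noncrossing hrs
    have hright := hrs.noncrossing h
    simp only [Crosses, order, mul_neg_iff, mul_pos_iff] at hc
    lia
  case outer.inner =>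
    have hk := fun hik hkj => h.not_skeletal (k := k) hik hkj hrs.2.1
    simp only [Crosses, order, mul_neg_iff, mul_pos_iff] at hc
    lia
  case outer.limit.right =>
    have hk := fun hik hkj => h.not_skeletal (k := k) hik hkj hrs.2
    simp only [Crosses, order, mul_neg_iff, mul_pos_iff] at hc
    lia
  case inner.inner =>
    simp only [Crosses, order, mul_neg_iff, mul_pos_iff] at hc
    lia
  all_goals exact hrs.elim

theorem Link.not_crosses (h : P.Link u v) (h' : P.Link r s) : ¬ Crosses u v r s := by
  rcases h'.essential_or_isSegment with he' | hseg'
  swap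
  · exact fun hc => hseg'.not_crosses u v (crosses_comm.1 hc)
  rcases h.essential_or_isSegment with he | hseg
  swap
  · exact hseg.not_crosses r s
  intro hc
  rcases u with i | i | i <;> rcases v with j | j | (_ | _)
  case outer.outer => exact not_crosses_of_unitChord h h' hc
  case inner.inner => exact he.2.1 ⟨i, Or.inr ⟨rfl, h.2 ▸ rfl⟩⟩
  all_goals first | exact h.elim | skip
  all_goals rcases r with k | k | k <;> rcases s with l | l | (_ | _)
  case outer.inner.inner.inner | outer.limit.right.inner.inner =>
    exact he'.2.1 ⟨k, Or.inr ⟨rfl, h'.2 ▸ rfl⟩⟩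
  case outer.inner.outer.outer | outer.limit.right.outer.outer =>
    exact not_crosses_of_unitChord h' h (crosses_comm.1 hc)
  case outer.inner.outer.inner =>
    obtain ⟨-, -, hi, hi'⟩ := h
    obtain ⟨-, -, hk, hk'⟩ := h'
    have hik := fun hlt : i + 1 ≤ k => P.height_mono hlt
    have hki := fun hlt : k + 1 ≤ i => P.height_mono hlt
    simp only [Crosses, order, mul_neg_iff, mul_pos_iff] at hc
    lia
  case outer.limit.right.outer.limit.right =>
    simp only [Crosses, order, mul_neg_iff, mul_pos_iff] at hc
    lia
  case outer.inner.outer.limit.right => exact h.1.ne' h'.1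
  case outer.limit.right.outer.inner => exact h'.1.ne' h.1
  all_goals exact h'.elim

variable (P)

theorem exists_link_of_skeletal (hk : P.Skeletal k) :
    ∃ w, P.Link (.outer k) w ∧ ∀ j, w ≠ .outer j := by
  rcases Nat.eq_zero_or_pos P.total with hm | hm
  · exact ⟨.limit .right, ⟨hm, hk⟩, nofun⟩
  · exact ⟨.inner (P.height k), ⟨hm, hk, le_rfl, P.height_mono (by lia)⟩, nofun⟩

variable {P}

theorem unitChord_of_not_crosses (hij : i < j)
    (h : ∀ r s, P.Link r s → ¬ Crosses (.outer i) (.outer j) r s) : P.UnitChord i j := by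
  refine P.unitChord_of_noncrossing hij (fun k hik hkj hk => ?_) (fun k l hik hkj hkl => ?_)
    (fun k l hil hlj hkl => ?_)
  · obtain ⟨w, hw, hne⟩ := P.exists_link_of_skeletal hk
    apply h _ _ hw
    rcases w with l | l | (_ | _)
    · exact (hne l rfl).elim
    all_goals simp only [Crosses, order, mul_neg_iff, mul_pos_iff]; lia
  all_goals
    by_contra hcon
    apply h (.outer k) (.outer l) hkl
    simp only [Crosses, order, mul_neg_iff, mul_pos_iff]
    lia

theorem skeletal_of_not_crosses (hv : ∀ j, v ≠ .outer j)
    (h : ∀ r s, P.Link r s → ¬ Crosses (.outer k) v r s) : P.Skeletal k := by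
  intro i j hij hik
  by_contra hkj
  apply h (.outer i) (.outer j) hij
  rcases v with l | l | (_ | _)
  · exact (hv l rfl).elim
  all_goals simp only [Crosses, order, mul_neg_iff, mul_pos_iff]; lia

theorem link_outer_inner_of_not_crosses (hm : 0 < P.total)
    (h : ∀ r s, P.Link r s → ¬ Crosses (.outer k) (.inner l) r s) :
    P.Link (.outer k) (.inner l) := by
  refine ⟨hm, skeletal_of_not_crosses (by simp) h, ?_, ?_⟩
  · by_contra! hlt
    obtain ⟨s, hsk, hs, hls⟩ := P.exists_skeletal_of_lt_height hlt
    apply h (.outer s) (.inner (P.height (s + 1))) ⟨hm, hs, P.height_mono (by lia), le_rfl⟩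
    simp only [Crosses, order, mul_neg_iff, mul_pos_iff]
    lia
  · by_contra! hlt
    obtain ⟨s, hks, hs, hsl⟩ := P.exists_skeletal_of_height_lt hlt
    apply h (.outer s) (.inner (P.height s)) ⟨hm, hs, le_rfl, P.height_mono (by lia)⟩
    simp only [Crosses, order, mul_neg_iff, mul_pos_iff]
    lia

theorem link_outer_limit_of_not_crosses {d : Direction}
    (h : ∀ r s, P.Link r s → ¬ Crosses (.outer k) (.limit d) r s) :
    P.Link (.outer k) (.limit d) := by
  cases d with
  | left =>
    obtain ⟨s, hsk, hs⟩ := P.exists_skeletal_lt k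
    obtain ⟨w, hw, hne⟩ := P.exists_link_of_skeletal hs
    apply (h _ _ hw).elim
    rcases w with l | l | (_ | _)
    · exact (hne l rfl).elim
    · simp only [Crosses, order, mul_neg_iff, mul_pos_iff]; lia
    · simp only [Crosses, order, mul_neg_iff, mul_pos_iff]; lia
    · exact hw.elim
  | right =>
    refine ⟨?_, skeletal_of_not_crosses (by simp) h⟩
    by_contra hm
    obtain ⟨s, hks, hs⟩ := P.exists_skeletal_gt k
    apply h (.outer s) (.inner (P.height s))
      ⟨Nat.pos_of_ne_zero hm, hs, le_rfl, P.height_mono (by lia)⟩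
    simp only [Crosses, order, mul_neg_iff, mul_pos_iff]
    lia

theorem exists_link_inner (hm : 0 < P.total) (l : ℤ) : ∃ k, P.Link (.outer k) (.inner l) :=
  (P.exists_skeletal_height hm l).imp fun _ hk => ⟨hm, hk⟩

theorem adj_inner_of_not_crosses (hm : 0 < P.total) (hv : .inner i ≠ v)
    (hv' : ∀ j, v ≠ .outer j) (h : ∀ r s, P.Link r s → ¬ Crosses (.inner i) v r s) :
    P.Adj (.inner i) v := by
  have hcross {l : ℤ} : ¬ ∀ k, Crosses (.inner i) v (.outer k) (.inner l) := fun hc =>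
    (exists_link_inner hm l).elim fun k hk => h _ _ hk (hc k)
  rcases v with j | j | (_ | _)
  · exact (hv' j rfl).elim
  · by_contra hadj
    have hij : i ≠ j := fun hij => hv (congrArg _ hij)
    have hj : j ≠ i + 1 := fun hj => hadj (Or.inl ⟨hm, hj⟩)
    have hi : i ≠ j + 1 := fun hi => hadj (Or.inr ⟨hm, hi⟩)
    refine hcross (l := min i j + 1) fun k => ?_
    simp only [Crosses, order, mul_neg_iff, mul_pos_iff]
    lia
  · refine (hcross (l := i + 1) fun k => ?_).elim
    simp [Crosses, order]
  · refine (hcross (l := i - 1) fun k => ?_).elim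
    simp [Crosses, order]

theorem adj_of_not_crosses (hu : u.IsMarked P.total) (hv : Valid P.total v) (huv : u ≠ v)
    (h : ∀ r s, P.Link r s → ¬ Crosses u v r s) : P.Adj u v := by
  have h' : ∀ r s, P.Link r s → ¬ Crosses v u r s := fun r s hrs =>
    crosses_swap.not.1 (h r s hrs)
  rcases u with i | i | i <;> rcases v with j | j | d
  · rcases lt_or_gt_of_ne (fun hij : i = j => huv (congrArg _ hij)) with hij | hij
    · exact Or.inl (unitChord_of_not_crosses hij h)
    · exact Or.inr (unitChord_of_not_crosses hij h')
  · exact Or.inl (link_outer_inner_of_not_crosses hv h)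
  · exact Or.inl (link_outer_limit_of_not_crosses h)
  · exact Or.inr (link_outer_inner_of_not_crosses hu h')
  · exact adj_inner_of_not_crosses hu huv nofun h
  · exact adj_inner_of_not_crosses hu huv nofun h
  all_goals exact hu.elim

variable (P) in
/-- The arcs of the annulus with a lift along an edge of the triangulation of the strip. -/
def arcs : Set (Arc P.n P.total) := {α | ∃ u v, P.Link u v ∧ HasLift α u v}

theorem Link.exists_geodesic (h : P.Link u v) (he : Essential u v) :
    ∃ α : Arc P.n P.total, HasLift α u v ∧
      ∃ S, IsTrace α S ∧ S ⊆ cover '' geodesic P.n P.total u v := by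
  have hc : SelfNoncrossing P.n P.total u v := fun τ => h.not_crosses (h.shift τ)
  rcases v with j | j | d
  · exact exists_geodesic_finite P.n_pos h.isMarked_left trivial he hc
  · refine exists_geodesic_finite P.n_pos h.isMarked_left ?_ he hc
    rcases u with i | i | i
    exacts [h.1, h.1, h.elim]
  · rcases u with i | i | i <;> cases d
    case outer.right => exact exists_geodesic_spiral P.n_pos i hc
    all_goals exact h.elim

variable (P)

theorem arcs_pairwise : P.arcs.Pairwise Compatible := by
  rintro α ⟨u, v, huv, hα⟩ β ⟨r, s, hrs, hβ⟩ hne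
  obtain ⟨α', hα', S, hS, hSg⟩ := huv.exists_geodesic (hα.essential P.n_pos)
  obtain ⟨β', hβ', S', hS', hSg'⟩ := hrs.exists_geodesic (hβ.essential P.n_pos)
  obtain rfl := hα.unique hα'
  obtain rfl := hβ.unique hβ'
  exact compatible_of_not_crosses P.n_pos hα hβ hne (fun τ => hrs.not_crosses (huv.shift τ)) hS hS'
    hSg hSg'

variable {P}

theorem mem_arcs_iff_adj {α : Arc P.n P.total} (hα : HasLift α u v) : α ∈ P.arcs ↔ P.Adj u v := by
  constructor
  · rintro ⟨r, s, hrs, hl⟩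
    obtain ⟨τ, ⟨rfl, rfl⟩ | ⟨rfl, rfl⟩⟩ := hl.eq_shift P.n_pos hα
    exacts [Or.inl (hrs.shift τ), Or.inr (hrs.shift τ)]
  · rintro (h | h)
    · exact ⟨u, v, h, hα⟩
    · cases α with
      | finite α => exact ⟨v, u, h, hα.symm⟩
      | asymptotic d α => exact (hα.2.1 ▸ h.isMarked_left : Vertex.IsMarked _ (.limit d)).elim

variable (P)

theorem isTriangulation_arcs : IsTriangulation P.arcs := by
  refine ⟨P.arcs_pairwise, fun S hS hle α hα => ?_⟩
  obtain ⟨u, v, hl⟩ := exists_hasLift P.n_pos α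
  by_contra hmem
  refine hmem ((mem_arcs_iff_adj hl).2 (adj_of_not_crosses hl.isMarked hl.valid_right
    (hl.essential P.n_pos).1 fun r s hrs hc => ?_))
  rcases hrs.essential_or_isSegment with he | hseg
  · obtain ⟨β, hβ, -⟩ := hrs.exists_geodesic he
    have hβmem : β ∈ P.arcs := ⟨r, s, hrs, hβ⟩
    exact not_crosses_of_compatible P.n_pos hl hβ
      (hS hα (hle hβmem) fun h => hmem (h ▸ hβmem)) hc
  · exact hseg.not_crosses u v (crosses_comm.1 hc)

variable {P}

theorem adj_of_liftJoins (hu : u.IsMarked P.total) (hv : v.IsMarked P.total)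
    (h : LiftJoins P.arcs (position P.n P.total u) (position P.n P.total v)) : P.Adj u v := by
  obtain ⟨c, hc, h0, h1, hmem⟩ := h
  exact (mem_arcs_iff_adj (α := .finite _) ⟨hu, hv, c, hc, h0, h1, rfl⟩).1 hmem

theorem adj_of_liftEscapes {d : Direction} (hu : u.IsMarked P.total)
    (h : LiftEscapes P.arcs (position P.n P.total u) d) : P.Adj u (.limit d) := by
  obtain ⟨ρ, hρ, h0, hmem⟩ := h
  exact (mem_arcs_iff_adj (α := .asymptotic d _) ⟨hu, rfl, ρ, hρ, h0, rfl⟩).1 hmem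

theorem Link.liftJoins (h : P.Link u v) (hv : v.IsMarked P.total) (he : Essential u v) :
    LiftJoins P.arcs (position P.n P.total u) (position P.n P.total v) := by
  obtain ⟨α, hα, -⟩ := h.exists_geodesic he
  have hmem : α ∈ P.arcs := ⟨u, v, h, hα⟩
  cases α with
  | finite α =>
    obtain ⟨-, -, c, hc, h0, h1, rfl⟩ := hα
    exact ⟨c, hc, h0, h1, hmem⟩
  | asymptotic d α => exact (hα.2.1 ▸ hv : Vertex.IsMarked _ (.limit d)).elim

theorem Link.liftEscapes {d : Direction} (h : P.Link u (.limit d)) (he : Essential u (.limit d)) :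
    LiftEscapes P.arcs (position P.n P.total u) d := by
  obtain ⟨α, hα, -⟩ := h.exists_geodesic he
  have hmem : α ∈ P.arcs := ⟨u, _, h, hα⟩
  cases α with
  | finite α => exact hα.2.1.elim
  | asymptotic d' α =>
    obtain ⟨-, hd, ρ, hρ, h0, rfl⟩ := hα
    cases hd
    exact ⟨ρ, hρ, h0, hmem⟩

theorem adj_of_edge (h : Edge P.arcs u v) : P.Adj u v := by
  cases h with
  | outer_outer k l h => exact adj_of_liftJoins (u := .outer k) (v := .outer l) trivial trivial h
  | inner_inner k l hm h => exact adj_of_liftJoins (u := .inner k) (v := .inner l) hm hm h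
  | outer_inner k l hm h => exact adj_of_liftJoins (u := .outer k) (v := .inner l) trivial hm h
  | outer_limit k d h => exact adj_of_liftEscapes (u := .outer k) trivial h
  | inner_limit k d hm h => exact adj_of_liftEscapes (u := .inner k) hm h
  | outer_segment k => exact Or.inl (P.unitChord_succ k)
  | inner_segment k hm => exact Or.inl ⟨hm, rfl⟩

theorem Link.edge (h : P.Link u v) : Edge P.arcs u v := by
  rcases h.essential_or_isSegment with he | ⟨k, ⟨rfl, rfl⟩ | ⟨rfl, rfl⟩⟩
  · rcases u with i | i | i <;> rcases v with j | j | d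
    · exact .outer_outer i j (h.liftJoins trivial he)
    · exact .outer_inner i j h.1 (h.liftJoins h.1 he)
    · exact .outer_limit i d (h.liftEscapes he)
    · exact h.elim
    · exact .inner_inner i j h.1 (h.liftJoins h.1 he)
    all_goals exact h.elim
  · exact .outer_segment k
  · exact .inner_segment k h.1

theorem edge_or_edge_iff_adj : Edge P.arcs u v ∨ Edge P.arcs v u ↔ P.Adj u v :=
  ⟨fun h => h.elim adj_of_edge fun h => (adj_of_edge h).symm, Or.imp Link.edge Link.edge⟩

end PeriodicPattern

/-! ### Counting triangles -/

section Triangles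

variable {V : Type*} {v : V}

theorem isNClique_three_and_mem_iff [DecidableEq V] {G : SimpleGraph V} {Δ : Finset V} :
    G.IsNClique 3 Δ ∧ v ∈ Δ ↔
      ∃ w w', G.Adj v w ∧ G.Adj v w' ∧ G.Adj w w' ∧ Δ = {v, w, w'} := by
  simp only [SimpleGraph.is3Clique_iff]
  constructor
  · rintro ⟨⟨a, b, c, hab, hac, hbc, rfl⟩, hv⟩
    simp only [Finset.mem_insert, Finset.mem_singleton] at hv
    rcases hv with rfl | rfl | rfl
    · exact ⟨b, c, hab, hac, hbc, rfl⟩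
    · exact ⟨a, c, hab.symm, hbc, hac, Finset.insert_comm ..⟩
    · exact ⟨a, b, hac.symm, hbc.symm, hab, by rw [Finset.pair_comm b, Finset.insert_comm]⟩
  · rintro ⟨w, w', hw, hw', hww', rfl⟩
    exact ⟨⟨v, w, w', hw, hw', hww', rfl⟩, by simp⟩

theorem injOn_triangle_of_injOn [DecidableEq V] {ψ : ℤ → V} {A : ℤ}
    (hψ : Set.InjOn ψ (Set.Icc 0 A)) (hv : ∀ t ∈ Set.Icc 0 A, ψ t ≠ v) :
    Set.InjOn (fun t => ({v, ψ t, ψ (t + 1)} : Finset V)) (Set.Ico 0 A) := by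
  have eq_or_eq {s t : ℤ} (hs : s ∈ Set.Ico 0 A) (ht : t ∈ Set.Ico 0 A)
      (h : ({v, ψ s, ψ (s + 1)} : Finset V) = {v, ψ t, ψ (t + 1)}) : s = t ∨ s = t + 1 := by
    have hs' : s ∈ Set.Icc 0 A := Set.Ico_subset_Icc_self hs
    have hmem : ψ s ∈ ({v, ψ t, ψ (t + 1)} : Finset V) := h ▸ by simp
    simp only [Finset.mem_insert, Finset.mem_singleton] at hmem
    exact (hmem.resolve_left (hv s hs')).imp (hψ hs' (Set.Ico_subset_Icc_self ht))
      (hψ hs' ⟨by linarith [ht.1], ht.2⟩)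
  intro s hs t ht h
  have hst := eq_or_eq hs ht h
  have hts := eq_or_eq ht hs h.symm
  lia

/-- The triangles at `v` are spanned by the pairs of neighbours with consecutive labels. -/
theorem encard_triangles_of_bijOn {G : SimpleGraph V} {label : V → ℤ} {A : ℕ}
    (hlabel : Set.BijOn label (G.neighborSet v) (Set.Icc 0 A))
    (hadj : ∀ w, G.Adj v w → ∀ w', G.Adj v w' → (G.Adj w w' ↔ |label w' - label w| = 1)) :
    {Δ : Finset V | G.IsNClique 3 Δ ∧ v ∈ Δ}.encard = A := by
  classical
  have : Nonempty V := ⟨v⟩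
  let ψ := Function.invFunOn label (G.neighborSet v)
  have hψ : Set.BijOn ψ (Set.Icc 0 A) (G.neighborSet v) :=
    hlabel.invOn_invFunOn.symm.bijOn hlabel.surjOn.mapsTo_invFunOn hlabel.mapsTo
  have label_ψ {t : ℤ} (ht : t ∈ Set.Icc (0 : ℤ) A) : label (ψ t) = t :=
    hlabel.invOn_invFunOn.2 ht
  have himage : {Δ : Finset V | G.IsNClique 3 Δ ∧ v ∈ Δ} =
      (fun t => {v, ψ t, ψ (t + 1)}) '' Set.Ico (0 : ℤ) A := by
    ext Δ
    simp only [Set.mem_ofPred_eq, isNClique_three_and_mem_iff, Set.mem_image]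
    constructor
    · rintro ⟨w, w', hw, hw', hww', rfl⟩
      have hlt := hadj w hw w' hw'
      obtain ⟨s, hs, rfl⟩ := hψ.surjOn hw
      obtain ⟨t, ht, rfl⟩ := hψ.surjOn hw'
      rw [label_ψ hs, label_ψ ht, abs_eq zero_le_one] at hlt
      rcases hlt.1 hww' with h | h
      · obtain rfl : t = s + 1 := by lia
        exact ⟨s, ⟨hs.1, ht.2⟩, rfl⟩
      · obtain rfl : s = t + 1 := by lia
        exact ⟨t, ⟨ht.1, hs.2⟩, by rw [Finset.pair_comm]⟩
    · rintro ⟨t, ht, rfl⟩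
      have ht0 : t ∈ Set.Icc (0 : ℤ) A := Set.Ico_subset_Icc_self ht
      have ht1 : t + 1 ∈ Set.Icc (0 : ℤ) A := ⟨by linarith [ht.1], ht.2⟩
      refine ⟨_, _, hψ.mapsTo ht0, hψ.mapsTo ht1, ?_, rfl⟩
      rw [hadj _ (hψ.mapsTo ht0) _ (hψ.mapsTo ht1), label_ψ ht0, label_ψ ht1]
      simp
  rw [himage, (injOn_triangle_of_injOn hψ.injOn fun t ht => (hψ.mapsTo ht).ne').encard_image,
    ← Finset.coe_Ico, Set.encard_coe_eq_coe_finsetCard, Int.card_Ico, sub_zero, Int.toNat_natCast]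

end Triangles

namespace PeriodicPattern

open AnnulusTriangulation PtolemyPattern

section Fan

variable {P : PeriodicPattern} {i j k l : ℤ} {w w' : Vertex}

variable (P) in
/-- The position of a neighbour of the outer vertex `k` in the fan of triangles at `k`; extends
`PtolemyPattern.label` to the neighbours off the outer boundary. -/
noncomputable def fanLabel (k : ℤ) : Vertex → ℤ
  | .outer j => P.label k j
  | .inner l => P.label k (P.last k) + 1 + (P.height (k + 1) - l)
  | .limit _ => P.label k (P.last k) + 1

theorem adj_outer_outer_iff : P.Adj (.outer i) (.outer j) ↔ P.L i j ^ 2 = 1 := by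
  constructor
  · rintro (h | h)
    exacts [h.L_sq_right, h.L_sq_left]
  · intro h
    rcases lt_trichotomy i j with hij | rfl | hij
    · exact Or.inl ⟨hij, (sq_eq_one_iff.1 h).resolve_right (by linarith [P.L_pos hij])⟩
    · simp [P.L_self] at h
    · rw [P.antisymm j i, neg_sq] at h
      exact Or.inr ⟨hij, (sq_eq_one_iff.1 h).resolve_right (by linarith [P.L_pos hij])⟩

theorem adj_iff_of_outer_outer (hi : P.L k i ^ 2 = 1) (hj : P.L k j ^ 2 = 1) :
    P.Adj (.outer i) (.outer j) ↔ |P.label k j - P.label k i| = 1 := by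
  rw [adj_outer_outer_iff, label_sub_label hi hj, abs_eq zero_le_one, ← sq_eq_one_iff,
    mul_pow, mul_pow, hi, hj, one_mul, one_mul]

theorem adj_outer_inner_iff : P.Adj (.outer k) (.inner l) ↔ P.Link (.outer k) (.inner l) :=
  or_iff_left id

theorem adj_outer_limit_iff : P.Adj (.outer k) (.limit .right) ↔ P.total = 0 ∧ P.Skeletal k :=
  or_iff_left id

theorem adj_iff_of_right_inner (hj : P.UnitChord k j) (hl : P.Link (.outer k) (.inner l)) :
    P.Adj (.outer j) (.inner l) ↔ |P.fanLabel k (.inner l) - P.label k j| = 1 := by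
  obtain ⟨hm, hk, -, hhi⟩ := hl
  have hle := label_le_label_last hj
  have hlast := label_eq_label_last_iff hj
  have hheight := P.height_last k
  rw [adj_outer_inner_iff, fanLabel, abs_eq zero_le_one]
  simp only [Link, skeletal_right_iff hk hj, hm, true_and]
  constructor
  · rintro ⟨rfl, h, -⟩
    lia
  · intro h
    obtain rfl := hlast.1 (by lia)
    have := P.height_mono (show P.last k ≤ P.last k + 1 by lia)
    exact ⟨rfl, by lia, by lia⟩

theorem adj_iff_of_left_inner (hi : P.UnitChord i k) (hl : P.Link (.outer k) (.inner l)) :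
    P.Adj (.outer i) (.inner l) ↔ |P.fanLabel k (.inner l) - P.label k i| = 1 := by
  obtain ⟨hm, hk, hlo, -⟩ := hl
  have hle := label_first_le_label hi
  have hfirst := label_eq_label_first_iff hi
  have hlabel := label_first_of_skeletal hk
  have hheight := P.height_first_add_one k
  rw [adj_outer_inner_iff, fanLabel, abs_eq zero_le_one]
  simp only [Link, skeletal_left_iff hk hi, hm, true_and]
  constructor
  · rintro ⟨rfl, -, h⟩
    lia
  · intro h
    obtain rfl := hfirst.1 (by lia)
    have := P.height_mono (show P.first k ≤ P.first k + 1 by lia)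
    exact ⟨rfl, by lia, by lia⟩

theorem adj_iff_of_right_limit (hj : P.UnitChord k j) (hk : P.Link (.outer k) (.limit .right)) :
    P.Adj (.outer j) (.limit .right) ↔ |P.fanLabel k (.limit .right) - P.label k j| = 1 := by
  obtain ⟨hm, hk⟩ := hk
  have hle := label_le_label_last hj
  rw [adj_outer_limit_iff, skeletal_right_iff hk hj, ← label_eq_label_last_iff hj, fanLabel,
    abs_eq zero_le_one]
  lia

theorem adj_iff_of_left_limit (hi : P.UnitChord i k) (hk : P.Link (.outer k) (.limit .right)) :
    P.Adj (.outer i) (.limit .right) ↔ |P.fanLabel k (.limit .right) - P.label k i| = 1 := by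
  obtain ⟨hm, hk⟩ := hk
  have hle := label_first_le_label hi
  have hlabel := label_first_of_skeletal hk
  have hheight := height_add_one_of_total hm k
  rw [adj_outer_limit_iff, skeletal_left_iff hk hi, ← label_eq_label_first_iff hi, fanLabel,
    abs_eq zero_le_one]
  lia

theorem adj_iff_of_outer (hj : P.Adj (.outer k) (.outer j)) (h : P.Link (.outer k) w) :
    P.Adj (.outer j) w ↔ |P.fanLabel k w - P.label k j| = 1 := by
  rcases w with l | l | (_ | _)
  · exact adj_iff_of_outer_outer (adj_outer_outer_iff.1 hj) h.L_sq_right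
  · exact hj.elim (adj_iff_of_right_inner · h) (adj_iff_of_left_inner · h)
  · exact hj.elim (fun hj => adj_iff_of_right_limit hj h) fun hj => adj_iff_of_left_limit hj h
  · exact h.elim

theorem adj_comm {u v : Vertex} : P.Adj u v ↔ P.Adj v u := or_comm

theorem adj_iff_abs_fanLabel_sub (h : P.Adj (.outer k) w) (h' : P.Adj (.outer k) w') :
    P.Adj w w' ↔ |P.fanLabel k w' - P.fanLabel k w| = 1 := by
  rcases w with i | i | (_ | _) <;> rcases w' with j | j | (_ | _)
  case outer.outer =>
    exact adj_iff_of_outer_outer (adj_outer_outer_iff.1 h) (adj_outer_outer_iff.1 h')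
  case outer.inner | outer.limit.right => exact adj_iff_of_outer h (h'.resolve_right id)
  case inner.outer | limit.right.outer =>
    rw [adj_comm, abs_sub_comm]
    exact adj_iff_of_outer h' (h.resolve_right id)
  case inner.inner =>
    have hm : 0 < P.total := (h.resolve_right id).1
    simp only [Adj, Link, hm, true_and, fanLabel, abs_eq zero_le_one]
    lia
  case inner.limit.right => exact ((h.resolve_right id).1.ne' (h'.resolve_right id).1).elim
  case limit.right.inner => exact ((h'.resolve_right id).1.ne' (h.resolve_right id).1).elim
  case limit.right.limit.right => simp [Adj, Link]
  all_goals first | exact (h.elim id id).elim | exact (h'.elim id id).elim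

theorem fanLabel_mem_Ioo (h : P.Link (.outer k) w) (hw : ∀ j, w ≠ .outer j) :
    P.fanLabel k w ∈ Set.Ioo (P.label k (P.last k)) (P.label k (P.first k)) := by
  rcases w with j | l | (_ | _)
  · exact (hw j rfl).elim
  · obtain ⟨-, hk, hlo, hhi⟩ := h
    rw [label_first_of_skeletal hk, Set.mem_Ioo, fanLabel]
    lia
  · obtain ⟨hm, hk⟩ := h
    rw [label_first_of_skeletal hk, height_add_one_of_total hm, Set.mem_Ioo, fanLabel]
    lia
  · exact h.elim

theorem fanLabel_ne_of_outer (h : P.Link (.outer k) w) (hw : ∀ j, w ≠ .outer j)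
    (hj : P.Adj (.outer k) (.outer j)) : P.fanLabel k w ≠ P.label k j := by
  have hmem := fanLabel_mem_Ioo h hw
  rcases hj with hj | hj
  · exact ((label_le_label_last hj).trans_lt hmem.1).ne'
  · exact (hmem.2.trans_le (label_first_le_label hj)).ne

variable (P k)

theorem fanLabel_injOn : Set.InjOn (P.fanLabel k) {w | P.Adj (.outer k) w} := by
  intro w (h : P.Adj _ _) w' (h' : P.Adj _ _) heq
  rcases w with i | i | (_ | _) <;> rcases w' with j | j | (_ | _)
  case outer.outer =>
    exact congrArg _ (eq_of_label_eq (adj_outer_outer_iff.1 h) (adj_outer_outer_iff.1 h') heq)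
  case outer.inner | outer.limit.right =>
    exact absurd heq.symm (fanLabel_ne_of_outer (h'.resolve_right id) nofun h)
  case inner.outer | limit.right.outer =>
    exact absurd heq (fanLabel_ne_of_outer (h.resolve_right id) nofun h')
  case inner.inner =>
    simp only [fanLabel] at heq
    exact congrArg _ (by lia)
  case inner.limit.right => exact ((h.resolve_right id).1.ne' (h'.resolve_right id).1).elim
  case limit.right.inner => exact ((h'.resolve_right id).1.ne' (h.resolve_right id).1).elim
  case limit.right.limit.right => rfl
  all_goals first | exact (h.elim id id).elim | exact (h'.elim id id).elim

theorem fanLabel_mapsTo :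
    Set.MapsTo (P.fanLabel k) {w | P.Adj (.outer k) w} (Set.Icc 0 (P.L (k - 1) (k + 1))) := by
  have hlast := (P.unitChord_last k).label_nonneg
  have hgap := P.gap_pos k
  have hfl := P.label_first k
  have hfirst := label_le_label_pred (P.unitChord_first k)
  have hopposite {w} (h : P.Link (.outer k) w) (hw : ∀ j, w ≠ .outer j) :
      P.fanLabel k w ∈ Set.Icc 0 (P.L (k - 1) (k + 1)) :=
    have hmem := fanLabel_mem_Ioo h hw
    ⟨hlast.trans hmem.1.le, hmem.2.le.trans hfirst⟩
  intro w (h : P.Adj _ _)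
  rcases w with j | l | d
  · rcases h with hj | hj
    · have := label_le_label_last hj
      exact ⟨hj.label_nonneg, by rw [fanLabel]; lia⟩
    · have := label_first_le_label hj
      exact ⟨by rw [fanLabel]; lia, label_le_label_pred hj⟩
  all_goals exact hopposite (h.resolve_right id) nofun

theorem fanLabel_surjOn :
    Set.SurjOn (P.fanLabel k) {w | P.Adj (.outer k) w} (Set.Icc 0 (P.L (k - 1) (k + 1))) := by
  intro t ht
  rcases le_or_gt t (P.label k (P.last k)) with hlast | hlast
  · obtain ⟨j, hj, hjt⟩ := (P.unitChord_last k).exists_label_right ht.1 hlast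
    exact ⟨.outer j, Or.inl hj, hjt⟩
  rcases le_or_gt (P.label k (P.first k)) t with hfirst | hfirst
  · obtain ⟨i, hi, hit⟩ := (P.unitChord_first k).exists_label_left hfirst ht.2
    exact ⟨.outer i, Or.inr hi, hit⟩
  have hk : P.Skeletal k := by
    by_contra hk
    have := P.label_first k
    rw [gap_eq_one hk] at this
    lia
  rw [label_first_of_skeletal hk] at hfirst
  rcases Nat.eq_zero_or_pos P.total with hm | hm
  · have := height_add_one_of_total hm k
    exact ⟨.limit .right, Or.inl ⟨hm, hk⟩, by rw [fanLabel]; lia⟩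
  · exact ⟨.inner (P.height (k + 1) - (t - P.label k (P.last k) - 1)),
      Or.inl ⟨hm, hk, by lia, by lia⟩, by rw [fanLabel]; lia⟩

theorem fanLabel_bijOn :
    Set.BijOn (P.fanLabel k) {w | P.Adj (.outer k) w} (Set.Icc 0 (P.L (k - 1) (k + 1))) :=
  ⟨P.fanLabel_mapsTo k, P.fanLabel_injOn k, P.fanLabel_surjOn k⟩

end Fan

variable (P : PeriodicPattern)

/-- The vertices and edges of the triangulation of the strip as a graph. -/
def graph : SimpleGraph Vertex where
  Adj := P.Adj
  symm := ⟨fun _ _ => Or.symm⟩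
  loopless := ⟨fun u h => by
    rcases u with i | i | i
    · exact h.elim (·.1.false) (·.1.false)
    · exact h.elim (fun h => by simpa using h.2) (fun h => by simpa using h.2)
    · exact h.elim id id⟩

theorem isTriangle_arcs_iff {Δ : Finset Vertex} :
    IsTriangle P.arcs Δ ↔ P.graph.IsNClique 3 Δ := by
  simp only [IsTriangle, edge_or_edge_iff_adj, SimpleGraph.isNClique_iff, SimpleGraph.isClique_iff,
    and_comm (a := Δ.card = 3)]
  rfl

theorem encard_triangles (k : ℤ) {A : ℕ} (hA : P.L (k - 1) (k + 1) = A) :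
    Set.encard {Δ : Finset Vertex | IsTriangle P.arcs Δ ∧ Vertex.outer k ∈ Δ} = A := by
  have hbij := P.fanLabel_bijOn k
  rw [hA] at hbij
  simp only [isTriangle_arcs_iff]
  exact encard_triangles_of_bijOn hbij fun w hw w' hw' => adj_iff_abs_fanLabel_sub hw hw'

end PeriodicPattern

theorem theorem4p6 (n : ℕ) (hn : 0 < n) (a : Fin n → ℕ) (F : Frieze)
    (hF : F.HasQuidditySequence a) :
    F.IsFinite ∨ ∃ m : ℕ, AnnulusTriangulation.RealizableIn a m := by
  by_cases h : F.width = ⊤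
  · let P := F.pattern h hn hF
    exact Or.inr ⟨P.total, P.arcs, P.isTriangulation_arcs, fun i =>
      P.encard_triangles i (hF.bracket_eq h i)⟩
  · exact Or.inl h
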